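/- Let $R$ denote the non-negative rational numbers. A two-commodity consumer data set is a finite list $(p_1,x_1),\dots,(p_m,x_m)\in R^2\times R^2$ of price vectors $p_i$ and purchased bundles $x_i$. The bundles are assumed pairwise distinct, and there are assumed to be no ties, i.e. $p_i\cdot x_i\neq p_i\cdot x_j$ whenever $i\neq j$. For $i\ne j$ write $x_i\succeq x_j$ if $p_i\cdot x_i\ge p_i\cdot x_j$. The data set satisfies GARP if, whenever $x_{i_1}\succeq x_{i_2}\succeq\cdots\succeq x_{i_r}$ (with $r\ge 2$), one has $x_{i_r}\not\succeq x_{i_1}$. The consumer rationality problem for two commodities is: given such a data set and an integer $k$, are there at most $k$ data points whose removal leaves a data set satisfying GARP? The input is written as a word with all numbers in binary (rationals as pairs of numerator and denominator in lowest terms). **Theorem.** The consumer rationality problem for two commodities is solvable in polynomial time: there are a Turing machine and a polynomial $q$ such that on every input the machine halts after at most $q(\text{input length})$ steps and outputs the correct answer. -/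

import Mathlib

open scoped NNRat

namespace RevealedPreference

/-- Given prices `p i` and chosen bundles `x i`, the bundle `x i` is directly revealed preferred to
`x j` when `j ≠ i` and `x j` was affordable when `x i` was chosen, i.e. `p i · x i ≥ p i · x j`. -/
def DirectlyRevealed {R ι κ : Type*} [NonUnitalNonAssocSemiring R] [LE R] [Fintype κ]
    (p x : ι → κ → R) (i j : ι) : Prop :=
  j ≠ i ∧ p i ⬝ᵥ x i ≥ p i ⬝ᵥ x j

/-- The axiom of revealed preference: whenever there is a chain
`x₁ ≽ x₂ ≽ ⋯ ≽ xₖ` (`k ≥ 2`) of direct revealed preferences, `xₖ ≽ x₁` fails. -/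
def GARP {R ι κ : Type*} [NonUnitalNonAssocSemiring R] [LE R] [Fintype κ]
    (p x : ι → κ → R) : Prop :=
  ∀ i j, Relation.TransGen (DirectlyRevealed p x) i j → ¬ DirectlyRevealed p x j i

/-- A finite consumer data set over `n` commodities, with non-negative rational prices and
quantities, pairwise distinct bundles, and no ties among the revealed preferences. -/
structure ConsumerData (n : ℕ) where
  size : ℕ
  price : Fin size → Fin n → ℚ≥0
  bundle : Fin size → Fin n → ℚ≥0
  bundle_injective : Function.Injective bundle
  no_ties : ∀ i j, i ≠ j → price i ⬝ᵥ bundle i ≠ price i ⬝ᵥ bundle j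

/-- An instance of the consumer rationality problem: a data set and an integer `k`. -/
structure Instance (n : ℕ) where
  data : ConsumerData n
  k : ℤ

/-- The consumer rationality problem: is there a collection `S` of at most `k` data points
whose removal leaves a data set satisfying GARP? -/
def ConsumerRationality (n : ℕ) (I : Instance n) : Prop :=
  ∃ S : Finset (Fin I.data.size), (S.card : ℤ) ≤ I.k ∧
    GARP (fun i : {i // i ∉ S} => I.data.price i) (fun i : {i // i ∉ S} => I.data.bundle i)

open Computability

/-- A natural number in binary. -/
def encNat (a : ℕ) : List Γ' :=
  (encodeNat a).map Γ'.bit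

/-- An integer: a sign bit, then the absolute value in binary. -/
def encInt (a : ℤ) : List Γ' :=
  Γ'.bit (decide (a < 0)) :: encNat a.natAbs

/-- A non-negative rational: numerator and denominator (in lowest terms) in binary,
each followed by a comma. -/
def encRat (q : ℚ≥0) : List Γ' :=
  encNat q.num ++ Γ'.comma :: (encNat q.den ++ [Γ'.comma])

/-- A vector: the list of its entries. -/
def encVec {n : ℕ} (v : Fin n → ℚ≥0) : List Γ' :=
  (List.ofFn v).flatMap encRat

/-- An instance: the integer `k`, then the data points one after the other, each written as
its price vector followed by its bundle and enclosed in brackets. -/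
def encInstance (n : ℕ) (I : Instance n) : List Γ' :=
  encInt I.k ++ (List.finRange I.data.size).flatMap fun i =>
    Γ'.bra :: (encVec (I.data.price i) ++ encVec (I.data.bundle i) ++ [Γ'.ket])

/-- The decision problem `P`, whose instances are written as words by `enc`, is solvable in
polynomial time: there are a (multi-stack) Turing machine and a polynomial `q` such that on every
instance `a` the machine halts after at most `q (length of enc a)` steps and outputs the truth
value of `P a`. -/
def SolvableInPolyTime {α Γ : Type} (enc : α → List Γ) (P : α → Prop) : Prop :=
  ∃ f : α → Bool, (∀ a, f a = true ↔ P a) ∧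
    Nonempty (Turing.TM2ComputableInPolyTime enc encodeBool f)

end RevealedPreference

/-! ### Structured programs for multi-stack machines -/

namespace StackMachine

open Turing Computability

/-! With two commodities a preference cycle never occurs without a pair of points revealed preferred
to each other: this is Rose's theorem, `garp_iff`, so only mutual pairs have to be destroyed. Orient
each such pair by the first coordinate; no ties are possible there, since mutual preference at equal
first coordinates would force each bundle to have less of the second commodity than the other. The
oriented relation is transitive (`violation_trans`), hence a strict partial order, and the question
becomes how few points must be removed to leave an antichain.

As in the proof of Dilworth's theorem from König's, this number is the size of a maximum matching in
the bipartite graph with two copies of every point, where the left copy of `u` is joined to the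
right copy of `v` if `u` is below `v`. A vertex cover of this graph projects to a removal set of no
larger size. Conversely, transitivity lets every matching edge be charged to a removed point of its
own (`auction_le_iff`). The matching, together with a cover certifying that it is maximum, comes
from an auction with integer prices (`auction_spec`), which needs at most n(n + 2) steps for n
points.

For the time bound, data are binary trees in prefix code on a single stack. Functions computable
there in polynomial time (`PolyTime`) are closed under composition, pairing, case distinction, and
folds whose intermediate states stay polynomially small (`PolyTime.foldl`). The whole decision
procedure is built from these operations, and `PolyTime.tm2Computable` turns it into a Turing
machine. -/

/-- The stacks: the input, the work stack, two auxiliary stacks and a unary counter. -/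
inductive Stk
  | inp | main | auxA | auxB | cnt
  deriving DecidableEq

instance : Fintype Stk :=
  ⟨{.inp, .main, .auxA, .auxB, .cnt}, fun k => by cases k <;> decide⟩

/-- The stack alphabets. All of them are finite. -/
abbrev Alph : Stk → Type
  | .inp => Γ'
  | _ => Bool

/-- The internal memory: the symbol read last. -/
abbrev Var : Type := Option Γ'

/-- Whether the symbol in memory is the bit `true`. -/
def Var.isTrue : Var → Bool
  | some (.bit b) => b
  | _ => false

@[simp] lemma Var.isTrue_bit (b : Bool) : Var.isTrue (some (.bit b)) = b := rfl

/-- The stack contents, stack by stack. -/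
def contents (i : List Γ') (m a b d : List Bool) : ∀ k, List (Alph k)
  | .inp => i
  | .main => m
  | .auxA => a
  | .auxB => b
  | .cnt => d

section contents

variable (i : List Γ') (m a b d : List Bool)

@[simp] lemma stacks_inp : contents i m a b d .inp = i := rfl
@[simp] lemma stacks_main : contents i m a b d .main = m := rfl
@[simp] lemma stacks_auxA : contents i m a b d .auxA = a := rfl
@[simp] lemma stacks_auxB : contents i m a b d .auxB = b := rfl
@[simp] lemma stacks_cnt : contents i m a b d .cnt = d := rfl

@[simp] lemma update_inp (x : List Γ') :
    Function.update (contents i m a b d) .inp x = contents x m a b d := by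
  funext k; cases k <;> rfl
@[simp] lemma update_main (x : List Bool) :
    Function.update (contents i m a b d) .main x = contents i x a b d := by
  funext k; cases k <;> rfl
@[simp] lemma update_auxA (x : List Bool) :
    Function.update (contents i m a b d) .auxA x = contents i m x b d := by
  funext k; cases k <;> rfl
@[simp] lemma update_auxB (x : List Bool) :
    Function.update (contents i m a b d) .auxB x = contents i m a x d := by
  funext k; cases k <;> rfl
@[simp] lemma update_cnt (x : List Bool) :
    Function.update (contents i m a b d) .cnt x = contents i m a b x := by
  funext k; cases k <;> rfl

end contents

/-- The configuration in which only the work stack is in use. -/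
abbrev work (w : List Bool) : ∀ k, List (Alph k) := contents [] w [] [] []

/-- `ReachIn f n a b`: iterating the partial function `f` leads from `a` to `b` in at most `n`
steps. -/
inductive ReachIn {α : Type*} (f : α → Option α) : ℕ → α → α → Prop
  | refl (n : ℕ) (a : α) : ReachIn f n a a
  | step {n : ℕ} {a b c : α} : f a = some b → ReachIn f n b c → ReachIn f (n + 1) a c

namespace ReachIn

variable {α : Type*} {f : α → Option α}

lemma mono {n m : ℕ} {a b : α} (h : ReachIn f n a b) (hnm : n ≤ m) : ReachIn f m a b := by
  induction h generalizing m with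
  | refl n a => exact .refl _ _
  | step h₁ _ ih =>
    obtain ⟨m, rfl⟩ : ∃ k, m = k + 1 := ⟨m - 1, by omega⟩
    exact .step h₁ (ih (by omega))

lemma trans {n m : ℕ} {a b c : α} (h : ReachIn f n a b) (h' : ReachIn f m b c) :
    ReachIn f (n + m) a c := by
  induction h with
  | refl n a => exact h'.mono (by omega)
  | step h₁ _ ih => exact (ReachIn.step h₁ (ih h')).mono (by omega)

lemma single {a b : α} (h : f a = some b) : ReachIn f 1 a b := .step h (.refl 0 _)

lemma exists_iterate {n : ℕ} {a b : α} (h : ReachIn f n a b) :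
    ∃ t ≤ n, (flip bind f)^[t] (some a) = some b := by
  induction h with
  | refl n a => exact ⟨0, Nat.zero_le _, rfl⟩
  | step h₁ _ ih =>
    obtain ⟨t, ht, h⟩ := ih
    refine ⟨t + 1, by omega, ?_⟩
    rw [Function.iterate_succ_apply]
    simpa [flip, h₁] using h

end ReachIn

/-! ### Programs and their control structures. -/

/-- A program: finitely many labels, a start label, and a statement for each label. -/
structure Mach where
  Lab : Type
  [fin : Fintype Lab]
  start : Lab
  prog : Lab → TM2.Stmt Alph Lab Var

attribute [instance] Mach.fin

/-- Rename the labels of a statement along `f`; instead of halting, continue at `e`, if given. -/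
def relabel {Λ Λ' : Type} (f : Λ → Λ') (e : Option Λ') :
    TM2.Stmt Alph Λ Var → TM2.Stmt Alph Λ' Var
  | .push k g q => .push k g (relabel f e q)
  | .peek k g q => .peek k g (relabel f e q)
  | .pop k g q => .pop k g (relabel f e q)
  | .load g q => .load g (relabel f e q)
  | .branch g q q' => .branch g (relabel f e q) (relabel f e q')
  | .goto g => .goto fun v => f (g v)
  | .halt => e.elim .halt fun l => .goto fun _ => l

/-- The label of a configuration after `relabel`. -/
def relabelTarget {Λ Λ' : Type} (f : Λ → Λ') (e : Option Λ') : Option Λ → Option Λ'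
  | none => e
  | some l => some (f l)

lemma stepAux_relabel {Λ Λ' : Type} (f : Λ → Λ') (e : Option Λ') (q : TM2.Stmt Alph Λ Var)
    (v : Var) (S : ∀ k, List (Alph k)) :
    TM2.stepAux (relabel f e q) v S =
      ⟨relabelTarget f e (TM2.stepAux q v S).l, (TM2.stepAux q v S).var,
        (TM2.stepAux q v S).stk⟩ := by
  induction q generalizing v S with
  | push k g q ih => simp [relabel, ih]
  | peek k g q ih => simp [relabel, ih]
  | pop k g q ih => simp [relabel, ih]
  | load g q ih => simp [relabel, ih]
  | branch g q q' ih ih' => cases h : g v <;> simp [relabel, h, ih, ih']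
  | goto g => simp [relabel, relabelTarget]
  | halt => cases e <;> simp [relabel, relabelTarget]

/-- A program embedded in a larger one is simulated step by step. Halting turns into a jump within
the same statement, so leaving the embedded program costs no extra step. -/
lemma ReachIn.relabel {Λ Λ' : Type} {f : Λ → Λ'} {e : Option Λ'}
    {P : Λ → TM2.Stmt Alph Λ Var} {P' : Λ' → TM2.Stmt Alph Λ' Var}
    (hP : ∀ l, P' (f l) = StackMachine.relabel f e (P l)) {n : ℕ} {c c' : TM2.Cfg Alph Λ Var}
    (h : ReachIn (TM2.step P) n c c') :
    ReachIn (TM2.step P') n ⟨relabelTarget f e c.l, c.var, c.stk⟩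
      ⟨relabelTarget f e c'.l, c'.var, c'.stk⟩ := by
  induction h with
  | refl n a => exact .refl _ _
  | @step n a b c h₁ _ ih =>
    obtain ⟨l, v, S⟩ := a
    cases l with
    | none => simp at h₁
    | some l =>
      refine .step ?_ ih
      simp only [TM2.step, Option.some.injEq] at h₁
      simp only [relabelTarget, TM2.step, hP, stepAux_relabel, h₁]

/-- Started with stacks `S`, the program halts after at most `n` steps with stacks `S'`. -/
def Runs (M : Mach) (S S' : ∀ k, List (Alph k)) (n : ℕ) : Prop :=
  ∀ v, ∃ v', ReachIn (TM2.step M.prog) n ⟨some M.start, v, S⟩ ⟨none, v', S'⟩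

lemma Runs.mono {M : Mach} {S S' : ∀ k, List (Alph k)} {n m : ℕ} (h : Runs M S S' n)
    (hnm : n ≤ m) : Runs M S S' m := fun v => (h v).imp fun _ h => h.mono hnm

namespace Mach

/-- Run `M`, then `N`. -/
def seq (M N : Mach) : Mach where
  Lab := M.Lab ⊕ N.Lab
  start := .inl M.start
  prog := Sum.elim (fun l => relabel .inl (some (.inr N.start)) (M.prog l))
    (fun l => relabel .inr none (N.prog l))

/-- Do nothing. -/
def skip : Mach where
  Lab := Unit
  start := ()
  prog _ := .halt

/-- Push a symbol on the work stack. -/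
def push (b : Bool) : Mach where
  Lab := Unit
  start := ()
  prog _ := .push .main (fun _ => b) .halt

/-- Remove a symbol from the work stack. -/
def pop : Mach where
  Lab := Unit
  start := ()
  prog _ := .pop .main (fun v _ => v) .halt

/-- Remove a symbol from the work stack and run `M` if it was `true`, and `N` otherwise. -/
def ite (M N : Mach) : Mach where
  Lab := Option (M.Lab ⊕ N.Lab)
  start := none
  prog
    | none => .pop .main (fun _ o => o.map Γ'.bit)
        (.branch (Var.isTrue) (.goto fun _ => some (.inl M.start))
          (.goto fun _ => some (.inr N.start)))
    | some (.inl l) => relabel (fun l => some (.inl l)) none (M.prog l)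
    | some (.inr l) => relabel (fun l => some (.inr l)) none (N.prog l)

/-- Remove a symbol from the work stack, and if it was `true`, run `M` and start again. -/
def loop (M : Mach) : Mach where
  Lab := Option M.Lab
  start := none
  prog
    | none => .pop .main (fun _ o => o.map Γ'.bit)
        (.branch (Var.isTrue) (.goto fun _ => some M.start) .halt)
    | some l => relabel some (some none) (M.prog l)

/-- Push the symbol in memory on an auxiliary stack if `c` holds. -/
def pushIf {Λ : Type} (c : Bool) (k : Stk) (hk : Alph k = Bool) (q : TM2.Stmt Alph Λ Var) :
    TM2.Stmt Alph Λ Var :=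
  cond c (.push k (fun v => cast hk.symm v.isTrue) q) q

/-- Remove the tree on top of the work stack, writing it to the chosen auxiliary stacks. -/
def takeTree (toA toB : Bool) : Mach where
  Lab := Bool
  start := true
  prog
    | true => .push .cnt (fun _ => true) (.goto fun _ => false)
    | false => .pop .cnt (fun _ o => o.map Γ'.bit)
        (.branch (fun v => v.isNone) .halt
          (.pop .main (fun _ o => o.map Γ'.bit)
            (pushIf toA .auxA rfl (pushIf toB .auxB rfl
              (.branch (Var.isTrue)
                (.push .cnt (fun _ => true) (.push .cnt (fun _ => true) (.goto fun _ => false)))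
                (.goto fun _ => false))))))

/-- Move the first auxiliary stack to the work stack. -/
def unloadA : Mach where
  Lab := Unit
  start := ()
  prog _ := .pop .auxA (fun _ o => o.map Γ'.bit)
    (.branch (fun v => v.isNone) .halt
      (.push .main (Var.isTrue) (.goto fun _ => ())))

/-- Move the second auxiliary stack to the work stack. -/
def unloadB : Mach where
  Lab := Unit
  start := ()
  prog _ := .pop .auxB (fun _ o => o.map Γ'.bit)
    (.branch (fun v => v.isNone) .halt
      (.push .main (Var.isTrue) (.goto fun _ => ())))

end Mach

namespace Runs

variable {M N : Mach} {S S' S'' : ∀ k, List (Alph k)} {n m : ℕ}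

lemma seq (h : Runs M S S' n) (h' : Runs N S' S'' m) : Runs (M.seq N) S S'' (n + m) := by
  intro v
  obtain ⟨v', h⟩ := h v
  obtain ⟨v'', h'⟩ := h' v'
  have h₁ := h.relabel (f := .inl) (e := some (.inr N.start)) (P' := (M.seq N).prog) fun l => rfl
  have h₂ := h'.relabel (f := .inr) (e := none) (P' := (M.seq N).prog) fun l => rfl
  exact ⟨v'', h₁.trans h₂⟩

lemma skip : Runs Mach.skip S S 1 := fun v => ⟨v, .single rfl⟩

lemma push (b : Bool) (w : List Bool) : Runs (Mach.push b) (work w) (work (b :: w)) 1 :=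
  fun v => ⟨v, .single (by simp [Mach.push])⟩

lemma pop (b : Bool) (w : List Bool) : Runs Mach.pop (work (b :: w)) (work w) 1 :=
  fun v => ⟨v, .single (by simp [Mach.pop])⟩

lemma ite_true {w : List Bool} (h : Runs M (work w) S n) :
    Runs (M.ite N) (work (true :: w)) S (n + 1) := by
  intro v
  obtain ⟨v', h⟩ := h (some (Γ'.bit true))
  refine ⟨v', .step ?_ (h.relabel (f := fun l => some (.inl l)) (e := none)
    (P' := (M.ite N).prog) fun l => rfl)⟩
  simp [Mach.ite, relabelTarget]

lemma ite_false {w : List Bool} (h : Runs N (work w) S n) :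
    Runs (M.ite N) (work (false :: w)) S (n + 1) := by
  intro v
  obtain ⟨v', h⟩ := h (some (Γ'.bit false))
  refine ⟨v', .step ?_ (h.relabel (f := fun l => some (.inr l)) (e := none)
    (P' := (M.ite N).prog) fun l => rfl)⟩
  simp [Mach.ite, relabelTarget]

lemma loop_false (w : List Bool) : Runs M.loop (work (false :: w)) (work w) 1 :=
  fun v => ⟨some (Γ'.bit false), .single (by simp [Mach.loop])⟩

lemma loop_true {w : List Bool} (h : Runs M (work w) S n) (h' : Runs M.loop S S' m) :
    Runs M.loop (work (true :: w)) S' (n + m + 1) := by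
  intro v
  obtain ⟨v', h⟩ := h (some (Γ'.bit true))
  obtain ⟨v'', h'⟩ := h' v'
  refine ⟨v'', .step ?_ ((h.relabel (f := some) (e := some none)
    (P' := M.loop.prog) fun l => rfl).trans h')⟩
  simp [Mach.loop, relabelTarget]

end Runs

/-! ### Moving prefix-coded trees between stacks. -/

/-- Binary trees, the data structures of the machines. -/
inductive BTree
  | leaf
  | node (l r : BTree)

/-- The prefix code of a tree. -/
def BTree.word : BTree → List Bool
  | leaf => [false]
  | node l r => true :: (l.word ++ r.word)

/-- The counter holds one symbol for each subtree still to be read: a leaf uses one up, a node uses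
one up and adds two. Hence reading stops exactly at the end of the code, whatever lies below it. -/
lemma reachIn_takeTree (toA toB : Bool) (t : BTree) (i : List Γ') (w a b d : List Bool) (v : Var) :
    ∃ v', ReachIn (TM2.step (Mach.takeTree toA toB).prog) t.word.length
      ⟨some false, v, contents i (t.word ++ w) a b (true :: d)⟩
      ⟨some false, v', contents i w (cond toA t.word.reverse [] ++ a)
        (cond toB t.word.reverse [] ++ b) d⟩ := by
  induction t generalizing w a b d v with
  | leaf =>
    refine ⟨some (Γ'.bit false), .single ?_⟩
    cases toA <;> cases toB <;> simp [BTree.word, Mach.takeTree, Mach.pushIf]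
  | node l r ihl ihr =>
    obtain ⟨v₁, h₁⟩ := ihl (r.word ++ w) (cond toA [true] [] ++ a) (cond toB [true] [] ++ b)
      (true :: d) (some (Γ'.bit true))
    obtain ⟨v₂, h₂⟩ := ihr w (cond toA l.word.reverse [] ++ (cond toA [true] [] ++ a))
      (cond toB l.word.reverse [] ++ (cond toB [true] [] ++ b)) d v₁
    refine ⟨v₂, ?_⟩
    have h := ReachIn.step (f := TM2.step (Mach.takeTree toA toB).prog)
      (a := ⟨some false, v, contents i ((BTree.node l r).word ++ w) a b (true :: d)⟩) ?_ (h₁.trans h₂)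
    · convert! h using 1
      · simp [BTree.word]
      · cases toA <;> cases toB <;> simp [BTree.word]
    · cases toA <;> cases toB <;> simp [BTree.word, Mach.takeTree, Mach.pushIf]

lemma runs_takeTree (toA toB : Bool) (t : BTree) (w a b : List Bool) :
    Runs (Mach.takeTree toA toB) (contents [] (t.word ++ w) a b [])
      (contents [] w (cond toA t.word.reverse [] ++ a) (cond toB t.word.reverse [] ++ b) [])
      (t.word.length + 2) := by
  intro v
  obtain ⟨v', h⟩ := reachIn_takeTree toA toB t [] w a b [] v
  refine ⟨none, ReachIn.step (b := ⟨some false, v, contents [] (t.word ++ w) a b [true]⟩) ?_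
    (h.trans (ReachIn.single ?_))⟩
  · simp [Mach.takeTree]
  · simp [Mach.takeTree]

lemma runs_unloadA (w a b : List Bool) :
    Runs Mach.unloadA (contents [] w a b []) (contents [] (a.reverse ++ w) [] b [])
      (a.length + 1) := by
  induction a generalizing w with
  | nil => exact fun v => ⟨none, .single (by simp [Mach.unloadA])⟩
  | cons x a ih =>
    intro v
    obtain ⟨v', h⟩ := ih (x :: w) (some (Γ'.bit x))
    refine ⟨v', ReachIn.step (b := ⟨some (), some (Γ'.bit x), contents [] (x :: w) a b []⟩) ?_ ?_⟩
    · cases x <;> simp [Mach.unloadA]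
    · simpa [work] using! h

lemma runs_unloadB (w b : List Bool) :
    Runs Mach.unloadB (contents [] w [] b []) (work (b.reverse ++ w)) (b.length + 1) := by
  induction b generalizing w with
  | nil => exact fun v => ⟨none, .single (by simp [Mach.unloadB])⟩
  | cons x b ih =>
    intro v
    obtain ⟨v', h⟩ := ih (x :: w) (some (Γ'.bit x))
    refine ⟨v', ReachIn.step (b := ⟨some (), some (Γ'.bit x), contents [] (x :: w) [] b []⟩) ?_ ?_⟩
    · cases x <;> simp [Mach.unloadB]
    · simpa [work] using! h

/-- Remove the tree on top of the work stack. -/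
def Mach.drop : Mach := takeTree false false

/-- Duplicate the tree on top of the work stack. -/
def Mach.dup : Mach := (takeTree true true).seq (unloadA.seq unloadB)

/-- Exchange the two trees on top of the work stack. -/
def Mach.swap : Mach :=
  (takeTree true false).seq ((takeTree false true).seq (unloadA.seq unloadB))

lemma runs_drop (t : BTree) (w : List Bool) :
    Runs Mach.drop (work (t.word ++ w)) (work w) (t.word.length + 2) := by
  exact runs_takeTree false false t w [] []

lemma runs_dup (t : BTree) (w : List Bool) :
    Runs Mach.dup (work (t.word ++ w)) (work (t.word ++ (t.word ++ w)))
      (3 * t.word.length + 4) := by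
  have h := (runs_takeTree true true t w [] []).seq ((runs_unloadA _ _ _).seq (runs_unloadB _ _))
  simp only [cond_true, List.append_nil, List.reverse_reverse, List.length_reverse] at h
  exact h.mono (by omega)

lemma runs_swap (t u : BTree) (w : List Bool) :
    Runs Mach.swap (work (t.word ++ (u.word ++ w))) (work (u.word ++ (t.word ++ w)))
      (2 * t.word.length + 2 * u.word.length + 6) := by
  have h := (runs_takeTree true false t (u.word ++ w) [] []).seq
    ((runs_takeTree false true u w _ _).seq ((runs_unloadA _ _ _).seq (runs_unloadB _ _)))
  simp only [cond_true, cond_false, List.append_nil, List.nil_append, List.reverse_reverse,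
    List.length_reverse] at h
  exact h.mono (by omega)

end StackMachine

/-! ### Functions computable in polynomial time -/

namespace StackMachine

open Turing Computability

/-- A type whose elements are represented by trees. -/
class Coded (α : Type) where
  code : α → BTree

section Coded

variable {α β : Type} [Coded α] [Coded β]

/-- The word representing an element of a coded type. -/
def enc (a : α) : List Bool := (Coded.code a).word

/-- The length of the word representing an element of a coded type. -/
def size (a : α) : ℕ := (enc a).length

instance : Coded Unit := ⟨fun _ => .leaf⟩

/-- Both codes have length five and they first differ in the second symbol, so sizes are constant
and a branch needs to inspect only that symbol. -/
instance : Coded Bool :=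
  ⟨fun b => cond b (.node (.node .leaf .leaf) .leaf) (.node .leaf (.node .leaf .leaf))⟩

instance : Coded (α × β) := ⟨fun p => .node (Coded.code p.1) (Coded.code p.2)⟩

/-- The tree representing a list. -/
def listCode : List α → BTree
  | [] => .leaf
  | a :: l => .node (Coded.code a) (listCode l)

instance : Coded (List α) := ⟨listCode⟩

lemma enc_pair (p : α × β) : enc p = true :: (enc p.1 ++ enc p.2) := rfl
lemma enc_nil : enc ([] : List α) = [false] := rfl
lemma enc_cons (a : α) (l : List α) : enc (a :: l) = true :: (enc a ++ enc l) := rfl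

@[simp] lemma size_unit (u : Unit) : size u = 1 := rfl
@[simp] lemma size_bool (b : Bool) : size b = 5 := by cases b <;> rfl
@[simp] lemma size_pair (a : α) (b : β) : size (a, b) = size a + size b + 1 := by
  simp [size, enc_pair]
@[simp] lemma size_nil : size ([] : List α) = 1 := rfl
@[simp] lemma size_cons (a : α) (l : List α) : size (a :: l) = size a + size l + 1 := by
  simp [size, enc_cons]

lemma size_prod (p : α × β) : size p = size p.1 + size p.2 + 1 := size_pair p.1 p.2

lemma size_pos (a : α) : 0 < size a := by
  unfold size enc
  cases Coded.code a <;> simp [BTree.word]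

lemma length_lt_size (l : List α) : l.length < size l := by
  induction l with
  | nil => simp
  | cons a l ih => simp; omega

lemma size_mem_le {a : α} {l : List α} (h : a ∈ l) : size a ≤ size l := by
  induction l with
  | nil => simp at h
  | cons b l ih =>
    rcases List.mem_cons.1 h with rfl | h
    · simp; omega
    · have := ih h; simp; omega

lemma size_list_eq {c : ℕ} (l : List α) (h : ∀ a ∈ l, size a = c) :
    size l = (c + 1) * l.length + 1 := by
  induction l with
  | nil => simp
  | cons a l ih =>
    rw [size_cons, ih fun x hx => h x (List.mem_cons_of_mem _ hx), h a List.mem_cons_self,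
      List.length_cons]
    ring

@[simp] lemma size_bools (l : List Bool) : size l = 6 * l.length + 1 :=
  size_list_eq l fun a _ => size_bool a

@[simp] lemma size_units (l : List Unit) : size l = 2 * l.length + 1 :=
  size_list_eq l fun _ _ => rfl

lemma size_tail_le (l : List α) : size l.tail ≤ size l := by
  cases l <;> simp; omega

lemma size_append (l l' : List α) : size (l ++ l') + 1 = size l + size l' := by
  induction l with
  | nil => simp; omega
  | cons a l ih => simp; omega

lemma size_reverse (l : List α) : size l.reverse = size l := by
  induction l with
  | nil => rfl
  | cons a l ih =>
    have := size_append l.reverse [a]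
    simp only [size_cons, size_nil] at this
    rw [List.reverse_cons, size_cons]; omega

end Coded

/-- Coefficients in `ℕ` make every polynomial monotone, which is what allows time bounds to be
composed. -/
lemma eval_mono (q : Polynomial ℕ) {m n : ℕ} (h : m ≤ n) : q.eval m ≤ q.eval n := by
  induction q using Polynomial.induction_on' with
  | add p q hp hq => simpa using Nat.add_le_add hp hq
  | monomial k c => simpa using Nat.mul_le_mul_left c (Nat.pow_le_pow_left h k)

section drop_swap

variable {α β : Type} [Coded α] [Coded β]

lemma runs_drop_enc (a : α) (w : List Bool) :
    Runs Mach.drop (work (enc a ++ w)) (work w) (size a + 2) := runs_drop _ w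

lemma runs_dup_enc (a : α) (w : List Bool) :
    Runs Mach.dup (work (enc a ++ w)) (work (enc a ++ (enc a ++ w))) (3 * size a + 4) :=
  runs_dup _ w

lemma runs_swap_enc (a : α) (b : β) (w : List Bool) :
    Runs Mach.swap (work (enc a ++ (enc b ++ w))) (work (enc b ++ (enc a ++ w)))
      (2 * size a + 2 * size b + 6) := runs_swap _ _ w

end drop_swap

/-- The function `f` is computed on the work stack in polynomial time, whatever lies below its
argument. -/
def PolyTime {α β : Type} [Coded α] [Coded β] (f : α → β) : Prop :=
  ∃ (M : Mach) (q : Polynomial ℕ), ∀ a, size (f a) ≤ q.eval (size a) ∧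
    ∀ w, Runs M (work (enc a ++ w)) (work (enc (f a) ++ w)) (q.eval (size a))

/-- Push a word on the work stack. -/
def Mach.pushAll : List Bool → Mach
  | [] => skip
  | b :: l => (pushAll l).seq (push b)

lemma runs_pushAll (l w : List Bool) :
    Runs (Mach.pushAll l) (work w) (work (l ++ w)) (l.length + 1) := by
  induction l with
  | nil => exact Runs.skip
  | cons b l ih => exact ih.seq (Runs.push b _)

namespace PolyTime

/-- Case distinction on a list. -/
def caseList {β γ : Type} (l : List β) (x : γ) (f : β → List β → γ) : γ :=
  match l with
  | [] => x
  | b :: t => f b t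

@[simp] lemma caseList_nil {β γ : Type} (x : γ) (f : β → List β → γ) : caseList [] x f = x := rfl
@[simp] lemma caseList_cons {β γ : Type} (b : β) (t : List β) (x : γ) (f : β → List β → γ) :
    caseList (b :: t) x f = f b t := rfl

variable {α β γ σ : Type} [Coded α] [Coded β] [Coded γ] [Coded σ]

lemma size_le {f : α → β} (hf : PolyTime f) :
    ∃ q : Polynomial ℕ, ∀ a, size (f a) ≤ q.eval (size a) := by
  obtain ⟨M, q, h⟩ := hf
  exact ⟨q, fun a => (h a).1⟩

lemma of_enc_eq {f : α → β} (h : ∀ a, enc (f a) = enc a) : PolyTime f := by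
  refine ⟨Mach.skip, Polynomial.X, fun a => ⟨?_, fun w => ?_⟩⟩
  · simp [size, h]
  · rw [h, Polynomial.eval_X]
    exact Runs.skip.mono (size_pos a)

protected lemma id : PolyTime (fun a : α => a) := of_enc_eq fun _ => rfl

lemma comp {g : β → γ} {f : α → β} (hg : PolyTime g) (hf : PolyTime f) :
    PolyTime (fun a => g (f a)) := by
  obtain ⟨M, p, hM⟩ := hf
  obtain ⟨N, q, hN⟩ := hg
  refine ⟨M.seq N, p + q.comp p, fun a => ⟨?_, fun w => ?_⟩⟩
  · simpa using ((hN (f a)).1.trans (eval_mono q (hM a).1)).trans (Nat.le_add_left _ _)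
  · simpa using ((hM a).2 w).seq (((hN (f a)).2 w).mono (eval_mono q (hM a).1))

lemma const (c : β) : PolyTime (fun _ : α => c) := by
  refine ⟨Mach.drop.seq (Mach.pushAll (enc c)), Polynomial.X + Polynomial.C (size c + 3),
    fun a => ⟨by simp; omega, fun w => ?_⟩⟩
  refine ((runs_drop_enc a w).seq (runs_pushAll (enc c) w)).mono ?_
  simp [size]; omega

lemma fst : PolyTime (Prod.fst : α × β → α) := by
  refine ⟨Mach.pop.seq (Mach.swap.seq Mach.drop), 5 * Polynomial.X + 10,
    fun p => ⟨by simp [size_prod]; omega, fun w => ?_⟩⟩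
  rw [enc_pair, List.cons_append, List.append_assoc]
  refine ((Runs.pop _ _).seq ((runs_swap_enc _ _ _).seq (runs_drop_enc _ _))).mono ?_
  simp [size_prod]; omega

lemma snd : PolyTime (Prod.snd : α × β → β) := by
  refine ⟨Mach.pop.seq Mach.drop, Polynomial.X + 3,
    fun p => ⟨by simp [size_prod]; omega, fun w => ?_⟩⟩
  rw [enc_pair, List.cons_append, List.append_assoc]
  refine ((Runs.pop _ _).seq (runs_drop_enc _ _)).mono ?_
  simp [size_prod]; omega

lemma pair {f : α → β} {g : α → γ} (hf : PolyTime f) (hg : PolyTime g) :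
    PolyTime (fun a => (f a, g a)) := by
  obtain ⟨M, p, hM⟩ := hf
  obtain ⟨N, q, hN⟩ := hg
  refine ⟨Mach.dup.seq (N.seq (Mach.swap.seq (M.seq (Mach.push true)))),
    5 * Polynomial.X + 11 + 2 * p + 3 * q, fun a => ?_⟩
  have h₁ := (hM a).1
  have h₂ := (hN a).1
  refine ⟨by simp; omega, fun w => ?_⟩
  have h := (runs_dup_enc a w).seq (((hN a).2 _).seq ((runs_swap_enc (g a) a w).seq
    (((hM a).2 _).seq (Runs.push true _))))
  rw [enc_pair, List.cons_append, List.append_assoc]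
  refine h.mono ?_
  simp; omega

/-- A nonempty list has the same word as the pair of its head and tail, so forming it costs nothing
beyond pairing. -/
lemma cons {f : α → β} {g : α → List β} (hf : PolyTime f) (hg : PolyTime g) :
    PolyTime (fun a => f a :: g a) :=
  (of_enc_eq (f := fun p : β × List β => p.1 :: p.2) fun _ => rfl).comp (hf.pair hg)

lemma cond {c : α → Bool} {f g : α → β} (hc : PolyTime c) (hf : PolyTime f) (hg : PolyTime g) :
    PolyTime (fun a => cond (c a) (f a) (g a)) := by
  suffices h : PolyTime (fun p : Bool × α => bif p.1 then f p.2 else g p.2) from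
    h.comp (hc.pair .id)
  obtain ⟨M, p, hM⟩ := hf
  obtain ⟨N, q, hN⟩ := hg
  -- The two pops remove the symbol of the pair and the first symbol of the Boolean; the branch
  -- reads the decisive second symbol, and three further pops discard the rest.
  refine ⟨Mach.pop.seq (Mach.pop.seq (Mach.ite
    (Mach.pop.seq (Mach.pop.seq (Mach.pop.seq M))) (Mach.pop.seq (Mach.pop.seq (Mach.pop.seq N))))),
    p + q + 10, fun ⟨b, a⟩ => ?_⟩
  have h₁ := eval_mono p (show size a ≤ size (b, a) by simp; omega)
  have h₂ := eval_mono q (show size a ≤ size (b, a) by simp; omega)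
  have h₃ := (hM a).1
  have h₄ := (hN a).1
  refine ⟨by cases b <;> simp only [cond_true, cond_false, Polynomial.eval_add] <;> omega,
    fun w => ?_⟩
  cases b
  · refine ((Runs.pop _ _).seq ((Runs.pop _ _).seq (Runs.ite_false
      ((Runs.pop _ _).seq ((Runs.pop _ _).seq ((Runs.pop _ _).seq ((hN a).2 w))))))).mono ?_
    simp only [Polynomial.eval_add, Polynomial.eval_ofNat]; omega
  · refine ((Runs.pop _ _).seq ((Runs.pop _ _).seq (Runs.ite_true
      ((Runs.pop _ _).seq ((Runs.pop _ _).seq ((Runs.pop _ _).seq ((hM a).2 w))))))).mono ?_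
    simp only [Polynomial.eval_add, Polynomial.eval_ofNat]; omega

lemma list_case {l : α → List β} {f : α → γ} {g : α → β → List β → γ} (hl : PolyTime l)
    (hf : PolyTime f) (hg : PolyTime (fun p : α × β × List β => g p.1 p.2.1 p.2.2)) :
    PolyTime (fun a => caseList (l a) (f a) (g a)) := by
  suffices h : PolyTime (fun p : List β × α => caseList p.1 (f p.2) (g p.2)) from
    h.comp (hl.pair .id)
  obtain ⟨M, p, hM⟩ := hf
  obtain ⟨N, q, hN⟩ := hg
  -- The constructor symbol of the list is the branching condition. In the nonempty case the stack
  -- then holds `b`, `t`, `a`; the pushes and the swap rearrange it to the code of `(a, b, t)`.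
  refine ⟨Mach.pop.seq (Mach.ite
    ((Mach.push true).seq (Mach.swap.seq ((Mach.push true).seq N))) M),
    p + q + 10 + 2 * Polynomial.X, fun ⟨l, a⟩ => ?_⟩
  have h₁ := eval_mono p (show size a ≤ size (l, a) by simp; omega)
  have h₃ := (hM a).1
  cases l with
  | nil =>
    refine ⟨by simp only [caseList_nil, Polynomial.eval_add]; omega, fun w => ?_⟩
    refine ((Runs.pop _ _).seq (Runs.ite_false ((hM a).2 w))).mono ?_
    simp only [Polynomial.eval_add, Polynomial.eval_ofNat]; omega
  | cons b t =>
    have h₂ := eval_mono q (show size (a, b, t) ≤ size (b :: t, a) by simp; omega)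
    have h₄ := (hN (a, b, t)).1
    refine ⟨by simp only [caseList_cons, Polynomial.eval_add] at *; omega, fun w => ?_⟩
    have h := (hN (a, b, t)).2 w
    rw [enc_pair (a, b, t), List.cons_append, List.append_assoc] at h
    have h := (Runs.pop true _).seq (Runs.ite_true (N := M) ((Runs.push true _).seq
      ((runs_swap_enc (b, t) a w).seq ((Runs.push true _).seq h))))
    rw [enc_pair, List.cons_append, List.append_assoc]
    refine Runs.mono (by simpa [enc_pair, enc_cons] using! h) ?_
    simp at *; omega

/-- The constructor symbols of the list itself control the loop: `true` announces another element,
`false` the end. The body puts back the symbol consumed by the test, adds that of the pair, runs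
`M`, and removes the pair symbol again. -/
lemma runs_foldl {f : β × σ → σ} {G : List β × σ → List β × σ} {M : Mach} {q : Polynomial ℕ}
    (hG : ∀ b l s, G (b :: l, s) = (l, f (b, s)))
    (hM : ∀ a w, Runs M (work (enc a ++ w)) (work (enc (G a) ++ w)) (q.eval (size a)))
    (B : ℕ) (w : List Bool) (l : List β) (s : σ)
    (hB : ∀ l', l' <+: l → size (l'.foldl (fun s b => f (b, s)) s) ≤ B) :
    Runs ((Mach.push true).seq ((Mach.push true).seq (M.seq Mach.pop))).loop
      (work (enc l ++ (enc s ++ w))) (work (enc (l.foldl (fun s b => f (b, s)) s) ++ w))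
      (l.length * (q.eval (size l + B + 1) + 4) + 1) := by
  induction l generalizing s with
  | nil => simpa [enc_nil] using Runs.loop_false (enc s ++ w)
  | cons b l ih =>
    have h₁ := ih (f (b, s)) fun l' hl' => hB (b :: l') (List.cons_prefix_cons.2 ⟨rfl, hl'⟩)
    have h₀ := hM (b :: l, s) w
    rw [hG, enc_pair (l, f (b, s)), List.cons_append, List.append_assoc, enc_pair,
      List.cons_append, List.append_assoc, enc_cons, List.cons_append, List.append_assoc] at h₀
    have h₂ := (Runs.push true _).seq ((Runs.push true _).seq (h₀.seq (Runs.pop true _)))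
    have h₃ := Runs.loop_true h₂ h₁
    rw [enc_cons, List.cons_append, List.append_assoc]
    have hs : size s ≤ B := hB [] List.nil_prefix
    refine h₃.mono ?_
    have e₁ := eval_mono q (show size (b :: l, s) ≤ size (b :: l) + B + 1 by simp; omega)
    have e₂ := Nat.mul_le_mul_left l.length
      (Nat.add_le_add_right (eval_mono q (show size l + B + 1 ≤ size (b :: l) + B + 1 by
        simp; omega)) 4)
    rw [List.length_cons, Nat.succ_mul]
    omega

/-- The bound on all intermediate states is essential, since iterating a polynomial-time step may
otherwise produce states of exponential size. -/
lemma foldl {l : α → List β} {s : α → σ} {f : α → σ → β → σ} (hl : PolyTime l) (hs : PolyTime s)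
    (hf : PolyTime (fun p : α × σ × β => f p.1 p.2.1 p.2.2))
    (hb : ∃ q : Polynomial ℕ, ∀ a l', l' <+: l a → size (l'.foldl (f a) (s a)) ≤ q.eval (size a)) :
    PolyTime (fun a => (l a).foldl (f a) (s a)) := by
  -- The loop body sees only the list and the state, so the parameter `a` travels in the state.
  let F : β × α × σ → α × σ := fun p => (p.2.1, f p.2.1 p.2.2 p.1)
  let G : List β × α × σ → List β × α × σ := fun p =>
    caseList p.1 (p.1, p.2) (fun b t => (t, F (b, p.2)))
  have hF : PolyTime F := (fst.comp snd).pair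
    (hf.comp ((fst.comp snd).pair ((snd.comp snd).pair fst)))
  have hG : PolyTime G := list_case fst (fst.pair snd)
    ((snd.comp snd).pair (hF.comp ((fst.comp snd).pair (snd.comp fst))))
  have hfold : ∀ (a : α) (l : List β) (s : σ),
      l.foldl (fun s b => F (b, s)) (a, s) = (a, l.foldl (f a) s) := by
    intro a l
    induction l with
    | nil => intro s; rfl
    | cons b l ih => intro s; exact ih _
  suffices h : PolyTime (fun a => (l a).foldl (fun s b => F (b, s)) (a, s a)) by
    have h' := snd.comp h
    simpa only [hfold] using h'
  obtain ⟨N, p, hN⟩ := hl.pair (PolyTime.id.pair hs)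
  obtain ⟨M, q, hM⟩ := hG
  obtain ⟨B, hB⟩ := hb
  refine ⟨N.seq (Mach.pop.seq
    ((Mach.push true).seq ((Mach.push true).seq (M.seq Mach.pop))).loop),
    p + p * (q.comp (p + (Polynomial.X + B + 1) + 1) + 4) + Polynomial.X + B + 5, fun a => ?_⟩
  have hBa : ∀ l', l' <+: l a → size (l'.foldl (fun s b => F (b, s)) (a, s a)) ≤
      size a + B.eval (size a) + 1 := by
    intro l' hl'
    rw [hfold, size_pair]
    have := hB a l' hl'
    omega
  refine ⟨(hBa _ List.prefix_rfl).trans (by simp; omega), fun w => ?_⟩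
  have h₁ := runs_foldl (f := F) (G := G) (M := M) (q := q) (fun b l s => rfl)
    (fun a => (hM a).2) _ w (l a) (a, s a) hBa
  have h₂ := (hN a).2 w
  rw [enc_pair (l a, a, s a), List.cons_append, List.append_assoc] at h₂
  refine (h₂.seq ((Runs.pop _ _).seq h₁)).mono ?_
  have e₁ : size (l a) ≤ p.eval (size a) := by
    have := (hN a).1
    rw [size_pair] at this
    omega
  have e₂ := (length_lt_size (l a)).le.trans e₁
  have e₃ := Nat.mul_le_mul e₂ (Nat.add_le_add_right (eval_mono q
    (show size (l a) + (size a + B.eval (size a) + 1) + 1 ≤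
      p.eval (size a) + (size a + B.eval (size a) + 1) + 1 by omega)) 4)
  simp only [Polynomial.eval_add, Polynomial.eval_mul, Polynomial.eval_comp, Polynomial.eval_X,
    Polynomial.eval_ofNat, Polynomial.eval_one]
  omega

/-- A fold whose state grows by a polynomially bounded amount in each step. -/
lemma foldl_of_add {l : α → List β} {s : α → σ} {f : α → σ → β → σ} (hl : PolyTime l)
    (hs : PolyTime s) (hf : PolyTime (fun p : α × σ × β => f p.1 p.2.1 p.2.2))
    (hb : ∃ q : Polynomial ℕ, ∀ a s b, size (f a s b) ≤ size s + q.eval (size a + size b)) :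
    PolyTime (fun a => (l a).foldl (f a) (s a)) := by
  refine foldl hl hs hf ?_
  obtain ⟨p, hp⟩ := hl.size_le
  obtain ⟨r, hr⟩ := hs.size_le
  obtain ⟨q, hq⟩ := hb
  refine ⟨r + p * q.comp (Polynomial.X + p), fun a l' hl' => ?_⟩
  have key : ∀ (l' : List β) (s : σ), (∀ b ∈ l', size b ≤ p.eval (size a)) →
      size (l'.foldl (f a) s) ≤ size s + l'.length * q.eval (size a + p.eval (size a)) := by
    intro l'
    induction l' with
    | nil => intro s _; simp
    | cons b l' ih =>
      intro s hl'
      have h₁ := ih (f a s b) fun x hx => hl' x (List.mem_cons_of_mem _ hx)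
      have h₂ := (hq a s b).trans (Nat.add_le_add_left (eval_mono q
        (Nat.add_le_add_left (hl' b List.mem_cons_self) (size a))) _)
      rw [List.foldl_cons, List.length_cons, Nat.succ_mul]
      omega
  have h₁ := key l' (s a) fun b hb => (size_mem_le (hl'.subset hb)).trans (hp a)
  have h₂ : l'.length ≤ p.eval (size a) :=
    (hl'.length_le.trans (length_lt_size _).le).trans (hp a)
  have h₃ := hr a
  have h₄ := Nat.mul_le_mul_right (q.eval (size a + p.eval (size a))) h₂
  simp only [Polynomial.eval_add, Polynomial.eval_mul, Polynomial.eval_comp, Polynomial.eval_X]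
  omega

end PolyTime

end StackMachine

/-! ### Input and output -/

namespace StackMachine

open Turing Computability

/-- Push a word on the work stack, then continue with `q`. -/
def pushWord {Λ : Type} (l : List Bool) (q : TM2.Stmt Alph Λ Var) : TM2.Stmt Alph Λ Var :=
  match l with
  | [] => q
  | b :: l => pushWord l (.push .main (fun _ => b) q)

lemma stepAux_pushWord {Λ : Type} (l : List Bool) (q : TM2.Stmt Alph Λ Var) (v : Var)
    (i : List Γ') (m a b d : List Bool) :
    TM2.stepAux (pushWord l q) v (contents i m a b d) =
      TM2.stepAux q v (contents i (l ++ m) a b d) := by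
  induction l generalizing q with
  | nil => rfl
  | cons x l ih => simp [pushWord, ih]

variable {S : Type} [Coded S]

/-- Read the input, writing the list of its symbols, in reverse order and translated by `sym`, to
the work stack. -/
def Mach.readInput (sym : Γ' → S) : Mach where
  Lab := Bool
  start := true
  prog
    | true => .push .main (fun _ => false) (.goto fun _ => false)
    | false => .pop .inp (fun _ o => o)
        (.branch (fun v => v == some .blank) (pushWord (true :: enc (sym .blank)) (.goto fun _ => false))
        (.branch (fun v => v == some (.bit true))
          (pushWord (true :: enc (sym (.bit true))) (.goto fun _ => false))
        (.branch (fun v => v == some (.bit false))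
          (pushWord (true :: enc (sym (.bit false))) (.goto fun _ => false))
        (.branch (fun v => v == some .bra) (pushWord (true :: enc (sym .bra)) (.goto fun _ => false))
        (.branch (fun v => v == some .ket) (pushWord (true :: enc (sym .ket)) (.goto fun _ => false))
        (.branch (fun v => v == some .comma)
          (pushWord (true :: enc (sym .comma)) (.goto fun _ => false))
          .halt))))))

lemma step_readInput (sym : Γ' → S) (x : Γ') (l : List Γ') (w : List Bool) (v : Var) :
    TM2.step (Mach.readInput sym).prog ⟨some false, v, contents (x :: l) w [] [] []⟩ =
      some ⟨some false, some x, contents l (true :: (enc (sym x) ++ w)) [] [] []⟩ := by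
  have h : ∀ x y : Γ', ((some x : Var) == some y) = decide (x = y) := fun x y => by
    by_cases h : x = y <;> simp [h]
  rcases x with _ | b | _ | _ | _
  · simp [Mach.readInput, stepAux_pushWord, h]
  · cases b <;> simp [Mach.readInput, stepAux_pushWord, h]
  all_goals simp [Mach.readInput, stepAux_pushWord, h]

lemma runs_readInput (sym : Γ' → S) (l : List Γ') :
    Runs (Mach.readInput sym) (contents l [] [] [] []) (work (enc (l.reverse.map sym)))
      (l.length + 2) := by
  have key : ∀ (l : List Γ') (s : List S) (v : Var),
      ReachIn (TM2.step (Mach.readInput sym).prog) (l.length + 1)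
        ⟨some false, v, contents l (enc s) [] [] []⟩
        ⟨none, none, work (enc (l.reverse.map sym ++ s))⟩ := by
    intro l
    induction l with
    | nil => exact fun s v => .single (by simp [Mach.readInput])
    | cons x l ih =>
      intro s v
      refine .step (step_readInput sym x l _ v) ?_
      have h := ih (sym x :: s) (some x)
      simpa [enc_cons] using! h
  intro v
  refine ⟨none, ReachIn.step (b := ⟨some false, v, contents l (enc ([] : List S)) [] [] []⟩) ?_ ?_⟩
  · simp [Mach.readInput, enc_nil]
  · simpa using! key l [] v

/-- Replace the Boolean on the work stack by a single symbol. -/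
def Mach.writeBool : Mach :=
  pop.seq (ite (pop.seq (pop.seq (pop.seq (push true)))) (pop.seq (pop.seq (pop.seq (push false)))))

lemma runs_writeBool (b : Bool) : Runs Mach.writeBool (work (enc b)) (work [b]) 6 := by
  cases b
  · exact (Runs.pop _ _).seq (Runs.ite_false
      ((Runs.pop _ _).seq ((Runs.pop _ _).seq ((Runs.pop _ _).seq (Runs.push _ _)))))
  · exact (Runs.pop _ _).seq (Runs.ite_true
      ((Runs.pop _ _).seq ((Runs.pop _ _).seq ((Runs.pop _ _).seq (Runs.push _ _)))))

/-- Clear the memory. -/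
def Mach.reset : Mach where
  Lab := Unit
  start := ()
  prog _ := .load (fun _ => none) .halt

/-- The bundled Turing machine given by a program. Its labels, its memory and all of its stack
alphabets are finite. -/
def Mach.toFinTM2 (M : Mach) : FinTM2 where
  K := Stk
  k₀ := .inp
  k₁ := .main
  Γ := Alph
  Λ := M.Lab
  main := M.start
  σ := Var
  initialState := none
  Γk₀Fin := inferInstanceAs (Fintype Γ')
  m := M.prog

lemma initList_toFinTM2 (M : Mach) (l : List Γ') :
    initList M.toFinTM2 l = ⟨some M.start, none, contents l [] [] [] []⟩ := by
  unfold initList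
  congr 1
  funext k
  cases k <;> rfl

lemma haltList_toFinTM2 (M : Mach) (l : List Bool) :
    haltList M.toFinTM2 l = ⟨none, none, work l⟩ := by
  unfold haltList
  congr 1
  funext k
  cases k <;> rfl

/-- A decision procedure that is computable in polynomial time on the work stack from the reverse
of the input word is computable in polynomial time. -/
theorem PolyTime.tm2Computable {ι : Type} (w : ι → List Γ') {sym : Γ' → S} {c : ℕ}
    (hc : ∀ x, size (sym x) ≤ c) {f : List S → Bool} (hf : PolyTime f) :
    Nonempty (TM2ComputableInPolyTime w encodeBool fun i => f ((w i).reverse.map sym)) := by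
  obtain ⟨M, q, hM⟩ := hf
  -- The final reset is needed because `haltList` requires the memory to have its initial value.
  let N : Mach := ((Mach.readInput sym).seq (M.seq Mach.writeBool)).seq Mach.reset
  -- The constant 9 is made up of 2 for reading beyond the input length, 6 for writing the answer
  -- and 1 for the reset.
  let p : Polynomial ℕ := q.comp (Polynomial.C (c + 1) * Polynomial.X + 1) + Polynomial.X + 9
  have hsize : ∀ l : List Γ', size (l.map sym) ≤ (c + 1) * l.length + 1 := by
    intro l
    induction l with
    | nil => simp
    | cons x l ih =>
      have := hc x
      simp only [List.map_cons, size_cons, List.length_cons, Nat.mul_succ]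
      omega
  have key : ∀ i, ∃ t ≤ p.eval (w i).length,
      (flip bind N.toFinTM2.step)^[t] (some (initList N.toFinTM2 (w i))) =
        some (haltList N.toFinTM2 (encodeBool (f ((w i).reverse.map sym)))) := by
    intro i
    rw [initList_toFinTM2, haltList_toFinTM2]
    have h₁ := (hM ((w i).reverse.map sym)).2 []
    rw [List.append_nil, List.append_nil] at h₁
    have h₂ := (runs_readInput sym (w i)).seq (h₁.seq (runs_writeBool _))
    obtain ⟨v, h₃⟩ := h₂ none
    have h₄ := h₃.relabel (f := .inl) (e := some (.inr ())) (P' := N.prog) fun l => rfl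
    have h₅ : ReachIn (TM2.step N.prog) 1
        ⟨some (.inr ()), v, work [f ((w i).reverse.map sym)]⟩
        ⟨none, none, work [f ((w i).reverse.map sym)]⟩ :=
      .single (by simp [N, Mach.seq, Mach.reset, relabel])
    obtain ⟨t, ht, h₆⟩ := (h₄.trans h₅).exists_iterate
    refine ⟨t, ht.trans ?_, h₆⟩
    have e := eval_mono q (hsize (w i).reverse)
    rw [List.length_reverse] at e
    simp only [p, Polynomial.eval_add, Polynomial.eval_comp, Polynomial.eval_mul,
      Polynomial.eval_C, Polynomial.eval_X, Polynomial.eval_one, Polynomial.eval_ofNat]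
    omega
  choose t ht h using key
  exact ⟨{
    tm := N.toFinTM2
    inputAlphabet := Equiv.refl Γ'
    outputAlphabet := Equiv.refl Bool
    time := p
    outputsFun := fun i => {
      steps := t i
      evals_in_steps := by
        have e₁ : (w i).map (Equiv.refl Γ').invFun = w i := List.map_id _
        have e₂ : ∀ b, (encodeBool b).map (Equiv.refl Bool).invFun = encodeBool b :=
          fun b => List.map_id _
        exact (congrArg (fun l => (flip bind N.toFinTM2.step)^[t i]
          (some (initList N.toFinTM2 l))) e₁).trans ((h i).trans
          (congrArg (fun l => some (haltList N.toFinTM2 l)) (e₂ _).symm))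
      steps_le_m := ht i } }⟩

end StackMachine

/-! ### Lists, binary arithmetic and matching as functions computable in polynomial time -/

attribute [fun_prop] StackMachine.PolyTime
attribute [fun_prop] StackMachine.PolyTime.id StackMachine.PolyTime.const StackMachine.PolyTime.comp
  StackMachine.PolyTime.pair StackMachine.PolyTime.cons StackMachine.PolyTime.cond
  StackMachine.PolyTime.list_case

namespace StackMachine

open PolyTime

/-! ### Basic functions on lists and Booleans. -/

section PolyTime

variable {α β γ σ : Type} [Coded α] [Coded β] [Coded γ] [Coded σ]

namespace PolyTime

@[fun_prop]
lemma fst_comp {f : α → β × γ} (hf : PolyTime f) : PolyTime (fun a => (f a).1) := fst.comp hf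

@[fun_prop]
lemma snd_comp {f : α → β × γ} (hf : PolyTime f) : PolyTime (fun a => (f a).2) := snd.comp hf

@[fun_prop]
lemma tail {l : α → List β} (hl : PolyTime l) : PolyTime (fun a => (l a).tail) := by
  have h : PolyTime (fun a => caseList (l a) (l a) (fun _ t => t)) := by fun_prop
  convert! h using 2 with a
  cases l a <;> rfl

@[fun_prop]
lemma drop (n : ℕ) {l : α → List β} (hl : PolyTime l) : PolyTime (fun a => (l a).drop n) := by
  induction n with
  | zero => simpa using hl
  | succ n ih => simpa using ih.tail

@[fun_prop]
lemma headD (d : β) {l : α → List β} (hl : PolyTime l) : PolyTime (fun a => (l a).headD d) := by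
  have h : PolyTime (fun a => caseList (l a) d (fun b _ => b)) := by fun_prop
  convert! h using 2 with a
  cases l a <;> rfl

@[fun_prop]
lemma not {b : α → Bool} (hb : PolyTime b) : PolyTime (fun a => !b a) := by
  have h : PolyTime (fun a => bif b a then false else true) := by fun_prop
  convert! h using 2 with a

@[fun_prop]
lemma and {b c : α → Bool} (hb : PolyTime b) (hc : PolyTime c) : PolyTime (fun a => b a && c a) := by
  have h : PolyTime (fun a => bif b a then c a else false) := by fun_prop
  convert! h using 2 with a
  cases b a <;> rfl

@[fun_prop]
lemma or {b c : α → Bool} (hb : PolyTime b) (hc : PolyTime c) : PolyTime (fun a => b a || c a) := by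
  have h : PolyTime (fun a => bif b a then true else c a) := by fun_prop
  convert! h using 2 with a

@[fun_prop]
lemma xor {b c : α → Bool} (hb : PolyTime b) (hc : PolyTime c) : PolyTime (fun a => b a ^^ c a) := by
  have h : PolyTime (fun a => bif b a then !c a else c a) := by fun_prop
  convert! h using 2 with a
  cases b a <;> simp

end PolyTime

/-- The reverse of the first list, followed by the second list. -/
def revAppend {β : Type} (l l' : List β) : List β := l.foldl (fun s b => b :: s) l'

@[simp] lemma revAppend_eq {β : Type} (l l' : List β) : revAppend l l' = l.reverse ++ l' := by
  simp [revAppend]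

lemma size_revAppend (l l' : List β) : size (revAppend l l') + 1 = size l + size l' := by
  rw [revAppend_eq, size_append, size_reverse]

@[fun_prop]
lemma PolyTime.revAppend {l l' : α → List β} (hl : PolyTime l) (hl' : PolyTime l') :
    PolyTime (fun a => revAppend (l a) (l' a)) := by
  refine foldl_of_add (f := fun _ s b => b :: s) hl hl' (by fun_prop)
    ⟨Polynomial.X + 1, fun a s b => ?_⟩
  simp; omega

/-- Whether the first list is shorter than the second one. -/
def shorter {β γ : Type} (l : List β) (l' : List γ) : Bool :=
  caseList (l.foldl (fun s _ => s.tail) l') false (fun _ _ => true)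

lemma shorter_iff {β γ : Type} (l : List β) (l' : List γ) :
    shorter l l' = true ↔ l.length < l'.length := by
  induction l generalizing l' with
  | nil => cases l' <;> simp [shorter]
  | cons b l ih =>
    cases l' with
    | nil => simpa [shorter] using ih []
    | cons c l' => simpa [shorter] using ih l'

@[fun_prop]
lemma PolyTime.shorter {l : α → List β} {l' : α → List γ} (hl : PolyTime l) (hl' : PolyTime l') :
    PolyTime (fun a => shorter (l a) (l' a)) := by
  have h : PolyTime (fun a => (l a).foldl (fun s _ => s.tail) (l' a)) :=
    foldl_of_add (f := fun _ s _ => s.tail) hl hl' (by fun_prop)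
      ⟨0, fun a s b => by simpa using size_tail_le s⟩
  unfold StackMachine.shorter
  fun_prop

/-- A list of units of the same length as the given list. -/
def units {β : Type} (l : List β) : List Unit := l.foldl (fun s _ => () :: s) []

@[simp] lemma length_units {β : Type} (l : List β) : (units l).length = l.length := by
  have h : ∀ s : List Unit, (l.foldl (fun s _ => () :: s) s).length = l.length + s.length := by
    induction l with
    | nil => simp
    | cons b l ih => intro s; rw [List.foldl_cons, ih, List.length_cons, List.length_cons]; omega
  exact h []

@[fun_prop]
lemma PolyTime.units {l : α → List β} (hl : PolyTime l) : PolyTime (fun a => units (l a)) := by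
  refine foldl_of_add (f := fun _ s _ => () :: s) hl (.const []) (by fun_prop)
    ⟨2, fun a s b => ?_⟩
  simp only [size_cons, size_unit, Polynomial.eval_ofNat]; omega

end PolyTime

/-! ### Binary arithmetic -/

/-- The value of a list of binary digits, the least significant one first. -/
def value : List Bool → ℕ
  | [] => 0
  | b :: l => b.toNat + 2 * value l

/-- One step of the addition of two binary numbers: the state holds the remaining digits, the carry
and the digits of the result. -/
def addStep (s : (List Bool × List Bool) × Bool × List Bool) :
    (List Bool × List Bool) × Bool × List Bool :=
  ((s.1.1.tail, s.1.2.tail),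
    (s.1.1.headD false && s.1.2.headD false) ||
      (s.2.1 && (s.1.1.headD false || s.1.2.headD false)),
    (s.1.1.headD false ^^ s.1.2.headD false ^^ s.2.1) :: s.2.2)

/-- Addition of binary numbers. -/
def addL (a b : List Bool) : List Bool :=
  let s := (revAppend a b).foldl (fun s _ => addStep s) ((a, b), false, [])
  revAppend s.2.2 [s.2.1]

/-- Multiplication of binary numbers. -/
def mulL (a b : List Bool) : List Bool :=
  (revAppend a []).foldl (fun s x => addL (false :: s) (bif x then b else [])) []

/-- One step of the comparison of two binary numbers: the state holds the remaining digits and the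
result for the digits seen so far. -/
def leStep (s : (List Bool × List Bool) × Bool) : (List Bool × List Bool) × Bool :=
  ((s.1.1.tail, s.1.2.tail),
    bif s.1.1.headD false ^^ s.1.2.headD false then s.1.2.headD false else s.2)

/-- Comparison of binary numbers. -/
def leL (a b : List Bool) : Bool :=
  ((revAppend a b).foldl (fun s _ => leStep s) ((a, b), true)).2

lemma value_append (a b : List Bool) : value (a ++ b) = value a + 2 ^ a.length * value b := by
  induction a with
  | nil => simp [value]
  | cons x a ih => simp [value, ih, pow_succ]; ring

lemma value_eq_headD (a : List Bool) : value a = (a.headD false).toNat + 2 * value a.tail := by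
  cases a <;> simp [value]

/-- Only the length of `l` matters; it must suffice to exhaust both summands. The invariant is that
the digits written, plus the carry and the remaining digits shifted by their number, have a constant
value. The length count is kept for the size bound in multiplication. -/
lemma addStep_iterate (l a b out : List Bool) (c : Bool) (ha : a.length ≤ l.length)
    (hb : b.length ≤ l.length) :
    let s := l.foldl (fun s _ => addStep s) ((a, b), c, out)
    value (revAppend s.2.2 [s.2.1]) =
        value out.reverse + 2 ^ out.length * (c.toNat + value a + value b) ∧
      s.2.2.length = l.length + out.length := by
  induction l generalizing a b c out with
  | nil =>
    obtain rfl : a = [] := List.length_eq_zero_iff.1 (by simpa using ha)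
    obtain rfl : b = [] := List.length_eq_zero_iff.1 (by simpa using hb)
    simp [value_append, value]
  | cons x l ih =>
    have h := ih a.tail b.tail (addStep ((a, b), c, out)).2.2 (addStep ((a, b), c, out)).2.1
      (by simp at *; omega) (by simp at *; omega)
    refine ⟨h.1.trans ?_, h.2.trans (by simp [addStep]; omega)⟩
    rw [value_eq_headD a, value_eq_headD b]
    simp only [addStep, List.reverse_cons, value_append, List.length_reverse, List.length_cons,
      pow_succ, value]
    generalize a.headD false = x
    generalize b.headD false = y
    cases x <;> cases y <;> cases c <;> simp <;> ring

@[simp] lemma value_addL (a b : List Bool) : value (addL a b) = value a + value b := by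
  have h := (addStep_iterate (revAppend a b) a b [] false (by simp) (by simp)).1
  simpa [addL, value] using h

@[simp] lemma length_addL (a b : List Bool) : (addL a b).length = a.length + b.length + 1 := by
  have h := (addStep_iterate (revAppend a b) a b [] false (by simp) (by simp)).2
  simp [addL] at *
  omega

@[simp] lemma value_mulL (a b : List Bool) : value (mulL a b) = value a * value b := by
  -- Multiplication is Horner's scheme starting from the most significant digit; folding from the
  -- right makes it recursive in `a`.
  rw [mulL, revAppend_eq, List.append_nil, List.foldl_reverse]
  induction a with
  | nil => simp [value]
  | cons x a ih =>
    rw [List.foldr_cons, value_addL, value, ih, value]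
    cases x <;> simp [value] <;> ring

/-- Digits come in increasing significance, so each differing pair overrides the verdict reached
before. -/
lemma leL_iterate (l a b : List Bool) (c : Bool) (ha : a.length ≤ l.length)
    (hb : b.length ≤ l.length) :
    (l.foldl (fun s _ => leStep s) ((a, b), c)).2 = true ↔ value a < value b ∨ value a = value b ∧ c = true := by
  induction l generalizing a b c with
  | nil =>
    obtain rfl : a = [] := List.length_eq_zero_iff.1 (by simpa using ha)
    obtain rfl : b = [] := List.length_eq_zero_iff.1 (by simpa using hb)
    simp
  | cons x l ih =>
    rw [List.foldl_cons, leStep, ih _ _ _ (by simp at *; omega) (by simp at *; omega)]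
    rw [value_eq_headD a, value_eq_headD b]
    generalize a.headD false = x
    generalize b.headD false = y
    cases x <;> cases y <;> cases c <;> simp <;> omega

lemma leL_iff (a b : List Bool) : leL a b = true ↔ value a ≤ value b := by
  rw [leL, leL_iterate _ _ _ _ (by simp) (by simp)]
  simp [le_iff_lt_or_eq]

section

variable {α : Type} [Coded α]

@[fun_prop]
lemma PolyTime.addL {a b : α → List Bool} (ha : PolyTime a) (hb : PolyTime b) :
    PolyTime (fun x => addL (a x) (b x)) := by
  have h : PolyTime (fun x => (StackMachine.revAppend (a x) (b x)).foldl (fun s _ => addStep s)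
      ((a x, b x), false, [])) := by
    refine foldl_of_add (f := fun _ s _ => addStep s) (by fun_prop) (by fun_prop)
      (by unfold addStep; fun_prop) ⟨6, fun x s b => ?_⟩
    have h₁ := size_tail_le s.1.1
    have h₂ := size_tail_le s.1.2
    rw [size_prod s, size_prod s.1, size_prod s.2]
    simp only [addStep, size_pair, size_cons, size_bool, Polynomial.eval_ofNat]
    omega
  unfold StackMachine.addL
  fun_prop

@[fun_prop]
-- Each Horner step lengthens the partial product by at most the number of digits of `b` plus two,
-- so growth is additive; each digit contributes 6 to the size.
lemma PolyTime.mulL {a b : α → List Bool} (ha : PolyTime a) (hb : PolyTime b) :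
    PolyTime (fun x => mulL (a x) (b x)) := by
  suffices h : PolyTime (fun p : List Bool × List Bool => StackMachine.mulL p.1 p.2) from
    h.comp (ha.pair hb)
  refine foldl_of_add (f := fun (p : List Bool × List Bool) s x =>
    StackMachine.addL (false :: s) (bif x then p.2 else [])) (by fun_prop) (by fun_prop)
    (by fun_prop) ⟨Polynomial.X + 12, fun p s x => ?_⟩
  have h := size_prod p
  cases x <;> simp only [size_bools, length_addL, List.length_cons, Polynomial.eval_add,
    Polynomial.eval_X, Polynomial.eval_ofNat, cond_true, cond_false, List.length_nil] at * <;> omega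

@[fun_prop]
lemma PolyTime.leL {a b : α → List Bool} (ha : PolyTime a) (hb : PolyTime b) :
    PolyTime (fun x => leL (a x) (b x)) := by
  refine PolyTime.snd_comp (foldl_of_add (f := fun _ s _ => leStep s)
    (l := fun x => StackMachine.revAppend (a x) (b x)) (s := fun x => ((a x, b x), true))
    (by fun_prop) (by fun_prop) (by unfold leStep; fun_prop) ⟨0, fun x s b => ?_⟩)
  have h₁ := size_tail_le s.1.1
  have h₂ := size_tail_le s.1.2
  rw [size_prod s, size_prod s.1]
  simp only [leStep, size_pair, size_bool, Polynomial.eval_zero]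
  omega

end

/-! ### Bipartite matching by auction -/

section Auction

variable {P : Type} (V : P → P → Bool)

/-- An offered item: the item, its price, and its owner, if any. -/
abbrev Entry (P : Type) : Type := P × List Unit × List P

/-- Compare an item with the best item found so far, and keep the better one. -/
def selectStep (u : P) (s : List (Entry P) × List (Entry P)) (e : Entry P) :
    List (Entry P) × List (Entry P) :=
  bif V u e.1 && caseList s.1 true (fun b _ => shorter e.2.1 b.2.1) then ([e], revAppend s.1 s.2)
  else (s.1, e :: s.2)

/-- Take an item of least price among those acceptable to `u` out of a list of items. -/
def select (u : P) (l : List (Entry P)) : List (Entry P) × List (Entry P) :=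
  l.foldl (selectStep V u) ([], [])

/-- One step of the auction: the first waiting bidder either buys a cheapest acceptable item, raising
its price and displacing its owner, or leaves, if the price exceeds the length of `N`. -/
def auctionStep (N : List Unit) (s : List P × List (Entry P)) : List P × List (Entry P) :=
  caseList s.1 s fun u us =>
    caseList (select V u s.2).1 (us, s.2) fun e _ =>
      bif shorter N e.2.1 then (us, s.2)
      else (revAppend e.2.2 us, (e.1, () :: e.2.1, [u]) :: (select V u s.2).2)

/-- A list bounding the number of steps of the auction. -/
def auctionFuel (l : List P) : List Unit :=
  l.foldl (fun s _ => () :: () :: revAppend (units l) s) []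

/-- The auction in which the members of a list are both the bidders and the items. -/
def auction (l : List P) : List P × List (Entry P) :=
  (auctionFuel l).foldl (fun s _ => auctionStep V (units l) s)
    (l, l.foldl (fun s p => (p, [], []) :: s) [])

/-- The number of items that have an owner, in binary. -/
def countSold (l : List (Entry P)) : List Bool :=
  l.foldl (fun s e => caseList e.2.2 s fun _ _ => addL s [true]) []

variable [Coded P] {V} {α : Type} [Coded α]

@[fun_prop]
lemma PolyTime.select (hV : PolyTime fun p : P × P => V p.1 p.2) {u : α → P}
    {l : α → List (Entry P)} (hu : PolyTime u) (hl : PolyTime l) :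
    PolyTime (fun a => select V (u a) (l a)) := by
  suffices h : PolyTime (fun p : P × List (Entry P) => StackMachine.select V p.1 p.2) from
    h.comp (hu.pair hl)
  have hV' : PolyTime (fun p : (P × List (Entry P)) × (List (Entry P) × List (Entry P)) ×
      Entry P => V p.1.1 p.2.2.1) :=
    hV.comp (f := fun p : (P × List (Entry P)) × (List (Entry P) × List (Entry P)) ×
      Entry P => (p.1.1, p.2.2.1)) (by fun_prop)
  refine foldl_of_add (f := fun (p : P × List (Entry P)) s (e : Entry P) => selectStep V p.1 s e)
    (by fun_prop) (by fun_prop) (by unfold selectStep; fun_prop) ⟨Polynomial.X + 3, fun p s e => ?_⟩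
  have h := size_revAppend s.1 s.2
  have h' := size_prod s
  unfold selectStep
  cases V p.1 e.1 && caseList s.1 true (fun b _ => StackMachine.shorter e.2.1 b.2.1) <;>
  · simp only [cond_true, cond_false, size_pair, size_cons, size_nil, Polynomial.eval_add,
      Polynomial.eval_X, Polynomial.eval_ofNat]
    omega

omit [Coded P] in
lemma select_perm (u : P) (l : List (Entry P)) :
    ((select V u l).1 ++ (select V u l).2).Perm l := by
  have key : ∀ (l : List (Entry P)) (s : List (Entry P) × List (Entry P)),
      ((l.foldl (selectStep V u) s).1 ++ (l.foldl (selectStep V u) s).2).Perm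
        (l ++ (s.1 ++ s.2)) := by
    intro l
    induction l with
    | nil => exact fun s => .refl _
    | cons e l ih =>
      intro s
      rw [List.foldl_cons]
      refine (ih _).trans ?_
      rw [List.cons_append]
      refine .trans (.append_left _ ?_) List.perm_middle
      unfold selectStep
      cases V u e.1 && caseList s.1 true (fun b _ => shorter e.2.1 b.2.1)
      · exact List.perm_middle
      · rw [cond_true, revAppend_eq]
        exact ((List.reverse_perm _).append_right _).cons e
  exact (key l ([], [])).trans (by simp)

lemma size_perm {l l' : List P} (h : l.Perm l') : size l = size l' := by
  induction h with
  | nil => rfl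
  | cons a _ ih => simp [ih]
  | swap a b l => simp; omega
  | trans _ _ ih ih' => exact ih.trans ih'

/-- Selection permutes the entries, and bidders only move between queue and items. All that is new
is one unit of price and a bounded number of constructor symbols. -/
lemma size_auctionStep_le (N : List Unit) (s : List P × List (Entry P)) :
    size (auctionStep V N s) ≤ size s + 10 := by
  obtain ⟨_ | ⟨u, us⟩, l⟩ := s
  · simp [auctionStep]
  · have h := size_perm (select_perm (V := V) u l)
    have h' := size_append (select V u l).1 (select V u l).2
    rcases hs : (select V u l).1 with _ | ⟨e, t⟩
    · simp [auctionStep, hs]; omega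
    · rw [hs] at h h'
      have h₁ := size_revAppend e.2.2 us
      have h₂ := size_prod e
      have h₃ := size_prod e.2
      have h₄ := size_pos t
      rw [size_cons] at h'
      simp only [auctionStep, hs, caseList_cons]
      cases shorter N e.2.1 <;>
      · simp only [cond_true, cond_false, size_pair, size_cons, size_nil, size_unit]
        omega

lemma PolyTime.auctionStep (hV : PolyTime fun p : P × P => V p.1 p.2) {N : α → List Unit}
    {s : α → List P × List (Entry P)} (hN : PolyTime N) (hs : PolyTime s) :
    PolyTime (fun a => auctionStep V (N a) (s a)) := by
  unfold StackMachine.auctionStep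
  refine PolyTime.list_case (by fun_prop) (by fun_prop) (PolyTime.list_case ?_ ?_ ?_)
  · exact (PolyTime.select hV (by fun_prop) (by fun_prop)).fst_comp
  · fun_prop
  · refine PolyTime.cond (by fun_prop) (by fun_prop) (PolyTime.pair (by fun_prop)
      (PolyTime.cons (by fun_prop) ?_))
    exact (PolyTime.select hV (by fun_prop) (by fun_prop)).snd_comp

@[fun_prop]
lemma PolyTime.auctionFuel {l : α → List P} (hl : PolyTime l) :
    PolyTime (fun a => auctionFuel (l a)) := by
  suffices h : PolyTime (fun l : List P => StackMachine.auctionFuel l) from h.comp hl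
  refine foldl_of_add (f := fun (l : List P) s _ =>
    () :: () :: StackMachine.revAppend (StackMachine.units l) s) (by fun_prop) (by fun_prop)
    (by fun_prop) ⟨2 * Polynomial.X + 5, fun l s b => ?_⟩
  have h := size_revAppend (StackMachine.units l) s
  have h' := length_lt_size l
  simp only [size_cons, size_unit, size_units, length_units, Polynomial.eval_add,
    Polynomial.eval_mul, Polynomial.eval_X, Polynomial.eval_ofNat] at *
  omega

lemma PolyTime.auction (hV : PolyTime fun p : P × P => V p.1 p.2) {l : α → List P}
    (hl : PolyTime l) : PolyTime (fun a => auction V (l a)) := by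
  suffices h : PolyTime (fun l : List P => StackMachine.auction V l) from h.comp hl
  have h : PolyTime (fun l : List P => l.foldl (fun s p => (p, [], []) :: s)
      ([] : List (Entry P))) := by
    refine foldl_of_add (f := fun _ s p => (p, [], []) :: s) (by fun_prop) (by fun_prop)
      (by fun_prop) ⟨Polynomial.X + 5, fun l s p => ?_⟩
    simp; omega
  exact foldl_of_add (f := fun (l : List P) s _ =>
    StackMachine.auctionStep V (StackMachine.units l) s) (by fun_prop) (by fun_prop)
    (PolyTime.auctionStep hV (by fun_prop) (by fun_prop))
    ⟨10, fun l s b => by simpa using size_auctionStep_le _ s⟩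

@[fun_prop]
lemma PolyTime.countSold {l : α → List (Entry P)} (hl : PolyTime l) :
    PolyTime (fun a => countSold (l a)) := by
  refine foldl_of_add (f := fun _ s (e : Entry P) => caseList e.2.2 s fun _ _ =>
    StackMachine.addL s [true]) hl (by fun_prop) (by fun_prop) ⟨12, fun a s e => ?_⟩
  cases e.2.2 <;> simp; omega

end Auction

end StackMachine

/-! ### Correctness of the auction -/

namespace StackMachine

open PolyTime

variable {P : Type} {V : P → P → Bool}

lemma select_spec (u : P) (l : List (Entry P)) :
    ((select V u l).1 = [] ∧ ∀ e ∈ l, V u e.1 = false) ∨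
      ∃ b, (select V u l).1 = [b] ∧ V u b.1 = true ∧
        ∀ e ∈ l, V u e.1 = true → b.2.1.length ≤ e.2.1.length := by
  induction l using List.reverseRecOn with
  | nil => exact .inl ⟨rfl, by simp⟩
  | append_singleton l e ih =>
    have hs : select V u (l ++ [e]) = selectStep V u (select V u l) e := by
      simp [select, List.foldl_append]
    rw [hs]
    rcases ih with ⟨h₁, h₂⟩ | ⟨b, h₁, h₂, h₃⟩
    · cases he : V u e.1
      · refine .inl ⟨by simp [selectStep, he, h₁], fun e' he' => ?_⟩
        rcases List.mem_append.1 he' with h | h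
        · exact h₂ e' h
        · rwa [List.mem_singleton.1 h]
      · refine .inr ⟨e, by simp [selectStep, he, h₁], he, fun e' he' hV => ?_⟩
        rcases List.mem_append.1 he' with h | h
        · simp [h₂ e' h] at hV
        · rw [List.mem_singleton.1 h]
    · by_cases hc : V u e.1 = true ∧ e.2.1.length < b.2.1.length
      · refine .inr ⟨e, by simp [selectStep, hc.1, h₁, (shorter_iff _ _).2 hc.2], hc.1, fun e' he' hV => ?_⟩
        rcases List.mem_append.1 he' with h | h
        · exact hc.2.le.trans (h₃ e' h hV)
        · rw [List.mem_singleton.1 h]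
      · refine .inr ⟨b, ?_, h₂, fun e' he' hV => ?_⟩
        · have hc' : (V u e.1 && shorter e.2.1 b.2.1) = false := by
            rw [← Bool.not_eq_true, Bool.and_eq_true, shorter_iff]
            exact hc
          simp [selectStep, h₁, hc']
        · rcases List.mem_append.1 he' with h | h
          · exact h₃ e' h hV
          · rw [List.mem_singleton.1 h] at hV ⊢
            by_contra hlt
            exact hc ⟨hV, not_le.1 hlt⟩

/-- The invariants of the auction with bidders and items `l`. -/
structure AuctionInv (V : P → P → Bool) (l : List P) (s : List P × List (Entry P)) : Prop where
  items : (s.2.map fun e => e.1).Perm l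
  nodup : (s.1 ++ s.2.flatMap fun e => e.2.2).Nodup
  subset : ∀ u ∈ s.1 ++ s.2.flatMap fun e => e.2.2, u ∈ l
  owner : ∀ e ∈ s.2, e.2.2.length ≤ 1
  sold : ∀ e ∈ s.2, e.2.1 ≠ [] → e.2.2 ≠ []
  acceptable : ∀ e ∈ s.2, ∀ u ∈ e.2.2, V u e.1 = true
  cheap : ∀ e ∈ s.2, ∀ u ∈ e.2.2, ∀ e' ∈ s.2, V u e'.1 = true →
    e.2.1.length ≤ e'.2.1.length + 1
  left : ∀ u ∈ l, u ∉ s.1 → (∀ e ∈ s.2, u ∉ e.2.2) → ∀ e' ∈ s.2, V u e'.1 = true →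
    l.length < e'.2.1.length
  price : ∀ e ∈ s.2, e.2.1.length ≤ l.length + 1

lemma AuctionInv.perm {l : List P} {f : List P} {L L' : List (Entry P)}
    (h : AuctionInv V l (f, L)) (hL : L.Perm L') : AuctionInv V l (f, L') where
  items := (hL.map _).symm.trans h.items
  nodup := ((hL.flatMap_right _).append_left f).nodup_iff.1 h.nodup
  subset u hu := h.subset u (((hL.flatMap_right _).append_left f).mem_iff.2 hu)
  owner e he := h.owner e (hL.mem_iff.2 he)
  sold e he := h.sold e (hL.mem_iff.2 he)
  acceptable e he := h.acceptable e (hL.mem_iff.2 he)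
  cheap e he u hu e' he' := h.cheap e (hL.mem_iff.2 he) u hu e' (hL.mem_iff.2 he')
  left u hu hf h' e' he' := h.left u hu hf (fun e he => h' e (hL.mem_iff.1 he)) e' (hL.mem_iff.2 he')
  price e he := h.price e (hL.mem_iff.2 he)

lemma AuctionInv.leave {l : List P} {u : P} {f : List P} {L : List (Entry P)}
    (h : AuctionInv V l (u :: f, L)) (hu : ∀ e ∈ L, V u e.1 = true → l.length < e.2.1.length) :
    AuctionInv V l (f, L) where
  items := h.items
  nodup := (List.nodup_cons.1 h.nodup).2
  subset x hx := h.subset x (List.mem_cons_of_mem _ hx)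
  owner := h.owner
  sold := h.sold
  acceptable := h.acceptable
  cheap := h.cheap
  left x hx hf h' := by
    by_cases hxu : x = u
    · exact hxu ▸ hu
    · exact h.left x hx (by simp [hxu, hf]) h'
  price := h.price

/-- The purchased item was a cheapest acceptable one, so after the rise it costs at most one more
than any alternative. Since no price ever falls, neither `cheap` for the other owners nor `left` can
be destroyed. -/
lemma AuctionInv.buy {l : List P} {u : P} {f : List P} {e : Entry P} {L : List (Entry P)}
    (h : AuctionInv V l (u :: f, e :: L)) (hu : V u e.1 = true)
    (hmin : ∀ e' ∈ e :: L, V u e'.1 = true → e.2.1.length ≤ e'.2.1.length)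
    (hp : e.2.1.length ≤ l.length) :
    AuctionInv V l (e.2.2.reverse ++ f, (e.1, () :: e.2.1, [u]) :: L) := by
  -- The bidder and the displaced owner trade places, so the multiset of waiting bidders and owners
  -- is unchanged.
  have hperm : (e.2.2.reverse ++ f ++ ([u] ++ L.flatMap fun e => e.2.2)).Perm
      (u :: f ++ (e.2.2 ++ L.flatMap fun e => e.2.2)) := by
    have h₁ : (e.2.2.reverse ++ f).Perm (f ++ e.2.2) :=
      List.perm_append_comm.trans ((List.reverse_perm _).append_left f)
    have h₂ := h₁.append_right ([u] ++ L.flatMap fun e => e.2.2)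
    refine h₂.trans ?_
    rw [List.singleton_append]
    refine List.perm_middle.trans ?_
    simp
  refine ⟨h.items, ?_, fun x hx => ?_, fun e' he' => ?_, fun e' he' => ?_, fun e' he' => ?_,
    fun e₁ he₁ x hx e₂ he₂ hV => ?_, fun x hx hf h' e' he' hV => ?_, fun e' he' => ?_⟩
  · exact hperm.nodup_iff.2 h.nodup
  · exact h.subset x (hperm.mem_iff.1 hx)
  · rcases List.mem_cons.1 he' with rfl | he'
    · simp
    · exact h.owner e' (List.mem_cons_of_mem _ he')
  · rcases List.mem_cons.1 he' with rfl | he'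
    · simp
    · exact h.sold e' (List.mem_cons_of_mem _ he')
  · rcases List.mem_cons.1 he' with rfl | he'
    · simpa using hu
    · exact h.acceptable e' (List.mem_cons_of_mem _ he')
  · rcases List.mem_cons.1 he₁ with rfl | he₁
    · obtain rfl : x = u := by simpa using hx
      rcases List.mem_cons.1 he₂ with rfl | he₂
      · simp
      · simpa using hmin e₂ (List.mem_cons_of_mem _ he₂) hV
    · rcases List.mem_cons.1 he₂ with rfl | he₂
      · have := h.cheap e₁ (List.mem_cons_of_mem _ he₁) x hx e List.mem_cons_self hV
        simp; omega
      · exact h.cheap e₁ (List.mem_cons_of_mem _ he₁) x hx e₂ (List.mem_cons_of_mem _ he₂) hV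
  · have hxu : x ≠ u := by
      have := h' _ List.mem_cons_self
      simpa using this
    have hxf : x ∉ u :: f := by simp [hxu] at hf ⊢; exact hf.2
    have hxe : ∀ e₁ ∈ e :: L, x ∉ e₁.2.2 := by
      intro e₁ he₁
      rcases List.mem_cons.1 he₁ with rfl | he₁
      · simp at hf; exact hf.1
      · exact h' e₁ (List.mem_cons_of_mem _ he₁)
    have key := h.left x hx hxf hxe
    rcases List.mem_cons.1 he' with rfl | he'
    · have := key e List.mem_cons_self hV
      simp; omega
    · exact key e' (List.mem_cons_of_mem _ he') hV
  · rcases List.mem_cons.1 he' with rfl | he'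
    · simpa using hp
    · exact h.price e' (List.mem_cons_of_mem _ he')

/-! ### Termination of the auction. -/

/-- A bound on the number of steps left. -/
def auctionRank (n : ℕ) (s : List P × List (Entry P)) : ℕ :=
  s.1.length + (s.2.map fun e => n + 1 - e.2.1.length).sum

/-- A departure shortens the queue. A purchase uses up one of the remaining price rises, while the
queue loses the bidder and regains at most one owner. Purchases happen only at prices at most
`l.length`, so the truncated subtraction in the rank really drops by one. -/
lemma AuctionInv.step {l : List P} {s : List P × List (Entry P)} (h : AuctionInv V l s) :
    AuctionInv V l (auctionStep V (units l) s) ∧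
      (s.1 = [] → auctionStep V (units l) s = s) ∧
      (s.1 ≠ [] →
        auctionRank l.length (auctionStep V (units l) s) + 1 ≤ auctionRank l.length s) := by
  obtain ⟨_ | ⟨u, us⟩, L⟩ := s
  · exact ⟨h, fun _ => rfl, fun h => absurd rfl h⟩
  suffices key : AuctionInv V l (auctionStep V (units l) (u :: us, L)) ∧
      auctionRank l.length (auctionStep V (units l) (u :: us, L)) + 1 ≤
        auctionRank l.length (u :: us, L) from
    ⟨key.1, fun h => absurd h (by simp), fun _ => key.2⟩
  have hperm := select_perm (V := V) u L
  rcases select_spec (V := V) u L with ⟨h₁, h₂⟩ | ⟨e, h₁, h₂, h₃⟩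
  · have hs : auctionStep V (units l) (u :: us, L) = (us, L) := by simp [auctionStep, h₁]
    rw [hs]
    exact ⟨h.leave fun e he hV => by simp [h₂ e he] at hV, by simp [auctionRank]⟩
  · have he : e ∈ L := hperm.subset (by simp [h₁])
    by_cases hp : l.length < e.2.1.length
    · have hs : auctionStep V (units l) (u :: us, L) = (us, L) := by
        simp [auctionStep, h₁, (shorter_iff (units l) e.2.1).2 (by simpa using hp)]
      rw [hs]
      exact ⟨h.leave fun e' he' hV => hp.trans_le (h₃ e' he' hV), by simp [auctionRank]⟩
    · have hs : auctionStep V (units l) (u :: us, L) =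
          (e.2.2.reverse ++ us, (e.1, () :: e.2.1, [u]) :: (select V u L).2) := by
        have : shorter (units l) e.2.1 = false := by
          rw [← Bool.not_eq_true, shorter_iff]
          simpa using hp
        simp [auctionStep, h₁, this]
      rw [h₁, List.singleton_append] at hperm
      rw [hs]
      refine ⟨(h.perm hperm.symm).buy h₂ (fun e' he' => h₃ e' (hperm.subset he')) (not_lt.1 hp), ?_⟩
      have hsum := (hperm.map fun e => l.length + 1 - e.2.1.length).sum_eq
      have howner := h.owner e he
      simp only [auctionRank, List.length_append, List.length_reverse, List.map_cons,
        List.sum_cons, List.length_cons] at *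
      omega

lemma AuctionInv.foldl {l : List P} (N : List Unit) {s : List P × List (Entry P)}
    (h : AuctionInv V l s) :
    AuctionInv V l (N.foldl (fun s _ => auctionStep V (units l) s) s) ∧
      (s.1 = [] ∨ auctionRank l.length s ≤ N.length →
        (N.foldl (fun s _ => auctionStep V (units l) s) s).1 = []) := by
  induction N generalizing s with
  | nil =>
    refine ⟨h, fun h' => h'.elim id fun h' => ?_⟩
    simp only [auctionRank, List.length_nil] at h'
    rw [List.foldl_nil]
    exact List.length_eq_zero_iff.1 (by omega)
  | cons x N ih =>
    obtain ⟨h₁, h₂, h₃⟩ := h.step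
    refine ⟨(ih h₁).1, fun h' => (ih h₁).2 ?_⟩
    by_cases hs : s.1 = []
    · exact .inl (by rw [h₂ hs, hs])
    · have := h₃ hs
      have := h'.resolve_left hs
      rw [List.length_cons] at this
      exact .inr (by omega)

/-- This is the initial rank: n waiting bidders, and n + 1 possible price rises for each of n items.
-/
lemma length_auctionFuel (l : List P) : (auctionFuel l).length = l.length * (l.length + 2) := by
  have key : ∀ (N : List Unit) (l : List P) (s : List Unit),
      (l.foldl (fun s _ => () :: () :: revAppend N s) s).length =
        l.length * (N.length + 2) + s.length := by
    intro N l
    induction l with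
    | nil => simp
    | cons a l ih =>
      intro s
      rw [List.foldl_cons, ih]
      simp; ring
  rw [auctionFuel, key]
  simp

lemma auctionInv_auction {l : List P} (hl : l.Nodup) :
    AuctionInv V l (auction V l) ∧ (auction V l).1 = [] := by
  have hinit : ∀ (l : List P) (s : List (Entry P)),
      l.foldl (fun s p => (p, [], []) :: s) s =
        (l.map fun p => ((p, [], []) : Entry P)).reverse ++ s := by
    intro l
    induction l with
    | nil => simp
    | cons a l ih => intro s; rw [List.foldl_cons, ih]; simp
  have hmem : ∀ e ∈ l.foldl (fun s p => (p, [], []) :: s) ([] : List (Entry P)),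
      e.2.1 = [] ∧ e.2.2 = [] := by
    intro e he
    rw [hinit, List.append_nil, List.mem_reverse, List.mem_map] at he
    obtain ⟨p, -, rfl⟩ := he
    exact ⟨rfl, rfl⟩
  have howner : ((l.foldl (fun s p => (p, [], []) :: s) ([] : List (Entry P))).flatMap
      fun e => e.2.2) = [] := List.flatMap_eq_nil_iff.2 fun e he => (hmem e he).2
  have h : AuctionInv V l (l, l.foldl (fun s p => (p, [], []) :: s) []) := by
    refine ⟨?_, ?_, fun u hu => ?_, fun e he => ?_, fun e he h => absurd (hmem e he).1 h,
      fun e he u hu => ?_, fun e he u hu => ?_, fun u hu hu' => absurd hu hu', fun e he => ?_⟩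
    · rw [hinit]
      simp only [List.append_nil, List.map_reverse, List.map_map]
      exact (List.reverse_perm _).trans (by simp [Function.comp_def])
    · simpa only [howner, List.append_nil] using hl
    · simpa [howner] using hu
    · simp [(hmem e he).2]
    · simp [(hmem e he).2] at hu
    · simp [(hmem e he).2] at hu
    · simp [(hmem e he).1]
  refine ⟨(h.foldl _).1, (h.foldl _).2 (.inr ?_)⟩
  rw [length_auctionFuel, auctionRank, hinit]
  simp [Function.comp_def]
  exact (by ring : _ = _).le

/-! ### The matching, its cover, and removal sets. -/

/-- The matching found by the auction. -/
def soldPairs (L : List (Entry P)) : List (P × P) :=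
  L.flatMap fun e => e.2.2.map fun u => (u, e.1)

lemma value_countSold (L : List (Entry P)) (h : ∀ e ∈ L, e.2.2.length ≤ 1) :
    value (countSold L) = (soldPairs L).length := by
  have key : ∀ s, value (L.foldl (fun s e => caseList e.2.2 s fun _ _ => addL s [true]) s) =
      (soldPairs L).length + value s := by
    induction L with
    | nil => simp [soldPairs]
    | cons e L ih =>
      intro s
      have h₁ := h e List.mem_cons_self
      rw [List.foldl_cons, ih fun e' he' => h e' (List.mem_cons_of_mem _ he')]
      rcases he : e.2.2 with _ | ⟨u, _ | ⟨u', t⟩⟩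
      · simp [soldPairs, he]
      · simp [soldPairs, he, value]; ring
      · simp [he] at h₁
  simpa [value] using! key []

/-- Every item dearer than `t` has a nonzero price and is therefore sold. Thus an item contributes
to only one of the two terms, and at most as much as it has owners. -/
lemma length_cover_le (L : List (Entry P)) (t : ℕ) (ht : ∀ e ∈ L, e.2.1.length ≠ t)
    (hsold : ∀ e ∈ L, e.2.1 ≠ [] → e.2.2 ≠ []) :
    ((L.filter fun e => e.2.1.length < t).flatMap fun e => e.2.2).length +
      ((L.filter fun e => t < e.2.1.length).map fun e => e.1).length ≤ (soldPairs L).length := by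
  induction L with
  | nil => simp
  | cons e L ih =>
    have h := ih (fun e' he' => ht e' (List.mem_cons_of_mem _ he'))
      fun e' he' => hsold e' (List.mem_cons_of_mem _ he')
    have h₁ := ht e List.mem_cons_self
    have h₂ := hsold e List.mem_cons_self
    have h₃ : (soldPairs (e :: L)).length = e.2.2.length + (soldPairs L).length := by
      simp [soldPairs]
    rw [h₃, List.filter_cons, List.filter_cons]
    rcases lt_or_gt_of_ne h₁ with hlt | hlt
    · simp only [hlt, not_lt_of_gt hlt, decide_true, decide_false, if_true, if_false,
        List.flatMap_cons, List.length_append, Bool.false_eq_true]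
      omega
    · have h₄ : 0 < e.2.2.length := List.length_pos_iff.2 (h₂ (List.length_pos_iff.1 (by omega)))
      simp only [hlt, not_lt_of_gt hlt, decide_true, decide_false, if_true, if_false,
        List.map_cons, List.length_cons, Bool.false_eq_true]
      omega

/-- The auction finds a matching `M` and a cover of all acceptable pairs that is not larger. -/
theorem auction_spec [DecidableEq P] {l : List P} (hl : l.Nodup) :
    ∃ M : Finset (P × P), M.card = value (countSold (auction V l).2) ∧
      (∀ e ∈ M, e.1 ∈ l ∧ e.2 ∈ l ∧ V e.1 e.2 = true) ∧
      Set.InjOn Prod.fst (M : Set (P × P)) ∧ Set.InjOn Prod.snd (M : Set (P × P)) ∧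
      ∃ A B : Finset P, A.card + B.card ≤ M.card ∧
        ∀ u ∈ l, ∀ v ∈ l, V u v = true → u ∈ A ∨ v ∈ B := by
  obtain ⟨h, hfree⟩ := auctionInv_auction (V := V) hl
  generalize auction V l = s at h hfree
  obtain ⟨f, L⟩ := s
  obtain rfl : f = [] := hfree
  have hfst : (soldPairs L).map Prod.fst = L.flatMap fun e => e.2.2 := by
    simp [soldPairs, List.map_flatMap, Function.comp_def]
  have hnd : ((soldPairs L).map Prod.fst).Nodup := by
    rw [hfst]
    simpa using h.nodup
  have hmem : ∀ p ∈ soldPairs L, ∃ e ∈ L, p.1 ∈ e.2.2 ∧ p.2 = e.1 := by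
    intro p hp
    obtain ⟨e, he, hp⟩ := List.mem_flatMap.1 hp
    obtain ⟨u, hu, rfl⟩ := List.mem_map.1 hp
    exact ⟨e, he, hu, rfl⟩
  have hitem : ∀ e ∈ L, ∀ e' ∈ L, e.1 = e'.1 → e = e' :=
    fun e he e' he' => List.inj_on_of_nodup_map (h.items.nodup_iff.2 hl) he he'
  have hcard : (soldPairs L).toFinset.card = (soldPairs L).length :=
    List.toFinset_card_of_nodup hnd.of_map
  refine ⟨(soldPairs L).toFinset, ?_, fun p hp => ?_, fun p hp p' hp' hpp => ?_,
    fun p hp p' hp' hpp => ?_, ?_⟩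
  · rw [value_countSold _ h.owner, hcard]
  · obtain ⟨e, he, h₁, h₂⟩ := hmem p (List.mem_toFinset.1 hp)
    refine ⟨h.subset _ ?_, ?_, ?_⟩
    · exact List.mem_append_right _ (List.mem_flatMap.2 ⟨e, he, h₁⟩)
    · exact h.items.subset (List.mem_map.2 ⟨e, he, h₂.symm⟩)
    · exact h₂ ▸ h.acceptable e he _ h₁
  · exact List.inj_on_of_nodup_map hnd (List.mem_toFinset.1 hp) (List.mem_toFinset.1 hp') hpp
  · obtain ⟨e, he, h₁, h₂⟩ := hmem p (List.mem_toFinset.1 hp)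
    obtain ⟨e', he', h₁', h₂'⟩ := hmem p' (List.mem_toFinset.1 hp')
    obtain rfl := hitem e he e' he' (h₂.symm.trans (hpp.trans h₂'))
    refine Prod.ext ?_ hpp
    obtain ⟨x, hx⟩ := List.length_eq_one_iff.1
      (le_antisymm (h.owner e he) (List.length_pos_of_mem h₁))
    rw [hx, List.mem_singleton] at h₁ h₁'
    exact h₁.trans h₁'.symm
  -- The interval has one more element than there are items, so some threshold `t` is not a price.
  -- The cover consists of the owners of items cheaper than `t` and of the items dearer than `t`.
  · obtain ⟨t, ht, htL⟩ : ∃ t ∈ Finset.Icc 1 (l.length + 1),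
        t ∉ (L.map fun e => e.2.1.length).toFinset := by
      refine Finset.exists_mem_notMem_of_card_lt_card ?_
      refine (List.toFinset_card_le _).trans_lt ?_
      have := h.items.length_eq
      simp only [List.length_map] at this
      simp [this]
    rw [Finset.mem_Icc] at ht
    have htL' : ∀ e ∈ L, e.2.1.length ≠ t := fun e he het =>
      htL (List.mem_toFinset.2 (List.mem_map.2 ⟨e, he, het⟩))
    refine ⟨((L.filter fun e => e.2.1.length < t).flatMap fun e => e.2.2).toFinset,
      ((L.filter fun e => t < e.2.1.length).map fun e => e.1).toFinset, ?_,
      fun u hu v hv hV => ?_⟩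
    · rw [hcard]
      exact (Nat.add_le_add (List.toFinset_card_le _) (List.toFinset_card_le _)).trans
        (length_cover_le L t htL' h.sold)
    · obtain ⟨e', he', rfl⟩ := List.mem_map.1 (h.items.symm.subset hv)
      have hcover : t ≤ e'.2.1.length →
          e'.1 ∈ ((L.filter fun e => t < e.2.1.length).map fun e => e.1).toFinset := by
        intro hle
        refine List.mem_toFinset.2 (List.mem_map.2 ⟨e', List.mem_filter.2 ⟨he', ?_⟩, rfl⟩)
        exact decide_eq_true (lt_of_le_of_ne hle (htL' e' he').symm)
      -- If `u` owns an item dearer than `t`, every item acceptable to `u` costs at least `t` by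
      -- `cheap`, hence more. If `u` owns nothing, it has left, and its acceptable items cost more
      -- than `l.length`, hence at least `t`.
      by_cases hown : ∃ e ∈ L, u ∈ e.2.2
      · obtain ⟨e, he, hue⟩ := hown
        rcases lt_or_gt_of_ne (htL' e he) with hlt | hlt
        · refine .inl (List.mem_toFinset.2 (List.mem_flatMap.2 ⟨e, List.mem_filter.2 ⟨he, ?_⟩, hue⟩))
          exact decide_eq_true hlt
        · exact .inr (hcover (by have := h.cheap e he u hue e' he' hV; omega))
      · push Not at hown
        exact .inr (hcover (by have := h.left u hu (by simp) hown e' he' hV; omega))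

/-- For a transitive relation on a list without repetitions, the number found by the auction is the
least number of members whose removal leaves no related pair. -/
theorem auction_le_iff {l : List P} (hl : l.Nodup)
    (htrans : ∀ u ∈ l, ∀ v ∈ l, ∀ w ∈ l, V u v = true → V v w = true → V u w = true) (k : ℕ) :
    value (countSold (auction V l).2) ≤ k ↔
      ∃ S : Finset P, S.card ≤ k ∧ ∀ u ∈ l, ∀ v ∈ l, u ∉ S → v ∉ S → V u v = false := by
  classical
  obtain ⟨M, hcard, hM, hinj₁, hinj₂, A, B, hAB, hcover⟩ := auction_spec (V := V) hl
  rw [← hcard]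
  constructor
  · intro h
    -- Forgetting which copy a covering vertex came from gives a removal set; this direction does
    -- not use transitivity.
    refine ⟨A ∪ B, (Finset.card_union_le _ _).trans (hAB.trans h), fun u hu v hv huS hvS => ?_⟩
    rw [← Bool.not_eq_true]
    intro hV
    rcases hcover u hu v hv hV with h | h
    · exact huS (Finset.mem_union_left _ h)
    · exact hvS (Finset.mem_union_right _ h)
  · rintro ⟨S, hS, hfree⟩
    refine le_trans ?_ hS
    -- Charge a matching edge to its lower end if that is removed and not above any survivor, and to
    -- its upper end otherwise. In the second case transitivity puts the upper end above a survivor,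
    -- so it must have been removed. Being above a survivor separates the two kinds of charges, and
    -- charges of one kind are distinct because the edges form a matching.
    let above : P → Prop := fun u => ∃ a ∈ l, a ∉ S ∧ V a u = true
    let g : P × P → P := fun e => if e.1 ∈ S ∧ ¬ above e.1 then e.1 else e.2
    have hg : ∀ e ∈ M, (e.1 ∈ S ∧ ¬ above e.1) ∨ (e.2 ∈ S ∧ above e.2) := by
      intro e he
      obtain ⟨h₁, h₂, h₃⟩ := hM e he
      by_cases hc : e.1 ∈ S ∧ ¬ above e.1
      · exact .inl hc
      · have habove : above e.2 := by
          by_cases he₁ : e.1 ∈ S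
          · obtain ⟨a, ha, haS, hV⟩ : above e.1 := by
              by_contra h
              exact hc ⟨he₁, h⟩
            exact ⟨a, ha, haS, htrans a ha e.1 h₁ e.2 h₂ hV h₃⟩
          · exact ⟨e.1, h₁, he₁, h₃⟩
        refine .inr ⟨?_, habove⟩
        by_contra he₂
        obtain ⟨a, ha, haS, hV⟩ := habove
        rw [hfree a ha e.2 h₂ haS he₂] at hV
        exact Bool.false_ne_true hV
    refine Finset.card_le_card_of_injOn g (fun e he => ?_) (fun e he e' he' hee => ?_)
    · by_cases hc : e.1 ∈ S ∧ ¬ above e.1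
      · simp [g, hc]
      · simpa [g, hc] using ((hg e he).resolve_left hc).1
    · by_cases hc : e.1 ∈ S ∧ ¬ above e.1 <;> by_cases hc' : e'.1 ∈ S ∧ ¬ above e'.1
      · exact hinj₁ he he' (by simpa only [g, if_pos hc, if_pos hc'] using hee)
      · have : e.1 = e'.2 := by simpa only [g, if_pos hc, if_neg hc'] using hee
        exact absurd (this ▸ ((hg e' he').resolve_left hc').2) hc.2
      · have : e.2 = e'.1 := by simpa only [g, if_neg hc, if_pos hc'] using hee
        exact absurd (this ▸ ((hg e he).resolve_left hc).2) hc'.2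
      · exact hinj₂ he he' (by simpa only [g, if_neg hc, if_neg hc'] using hee)

end StackMachine

/-! ### Two commodities -/

namespace RevealedPreference

section Plane

variable {ι : Type*} (p x : ι → Fin 2 → ℚ≥0)

/-- How much more than `x i` the bundle `x j` costs at the prices `p i`. -/
def gap (i j : ι) : ℚ :=
  p i 0 * ((x j 0 : ℚ) - x i 0) + p i 1 * ((x j 1 : ℚ) - x i 1)

@[simp] lemma gap_self (i : ι) : gap p x i i = 0 := by simp [gap]

lemma gap_eq (i j : ι) : gap p x i j = ((p i ⬝ᵥ x j : ℚ≥0) : ℚ) - ((p i ⬝ᵥ x i : ℚ≥0) : ℚ) := by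
  simp only [gap, dotProduct, Fin.sum_univ_two]
  push_cast
  ring

lemma directlyRevealed_iff {i j : ι} :
    DirectlyRevealed p x i j ↔ j ≠ i ∧ gap p x i j ≤ 0 := by
  rw [DirectlyRevealed, gap_eq, sub_nonpos, NNRat.cast_le, ge_iff_le]

variable {p x}

lemma gap_ne_zero (h : ∀ i j, i ≠ j → p i ⬝ᵥ x i ≠ p i ⬝ᵥ x j) {i j : ι} (hij : i ≠ j) :
    gap p x i j ≠ 0 := by
  rw [gap_eq, sub_ne_zero]
  exact fun h' => h i j hij (NNRat.cast_injective h').symm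

/-- Of three points, the middle one cannot be seen to lie both below and above the segment between
the outer ones. -/
lemma not_below_and_above {i j a m b : ι}
    (h₁ : ((x b 0 : ℚ) - x a 0) * gap p x i m <
      ((x b 0 : ℚ) - x m 0) * gap p x i a + ((x m 0 : ℚ) - x a 0) * gap p x i b)
    (h₂ : ((x b 0 : ℚ) - x m 0) * gap p x j a + ((x m 0 : ℚ) - x a 0) * gap p x j b <
      ((x b 0 : ℚ) - x a 0) * gap p x j m) : False := by
  -- The deviation of the cost at prices `p k` from linear interpolation is the second price times a
  -- determinant independent of `k`. As second prices are nonnegative, it cannot have strictly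
  -- opposite signs for `i` and `j`.
  have e : ∀ k, ((x b 0 : ℚ) - x m 0) * gap p x k a + ((x m 0 : ℚ) - x a 0) * gap p x k b -
      ((x b 0 : ℚ) - x a 0) * gap p x k m =
      p k 1 * (((x b 0 : ℚ) - x m 0) * x a 1 + ((x m 0 : ℚ) - x a 0) * x b 1 -
        ((x b 0 : ℚ) - x a 0) * x m 1) := fun k => by simp only [gap]; ring
  have e₁ := e i
  have e₂ := e j
  have hi : (0 : ℚ) ≤ p i 1 := NNRat.cast_nonneg _
  have hj : (0 : ℚ) ≤ p j 1 := NNRat.cast_nonneg _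
  generalize ((x b 0 : ℚ) - x m 0) * x a 1 + ((x m 0 : ℚ) - x a 0) * x b 1 -
        ((x b 0 : ℚ) - x a 0) * x m 1 = K at e₁ e₂
  rcases le_total K 0 with hK | hK
  · have := mul_nonpos_of_nonneg_of_nonpos hi hK
    linarith
  · have := mul_nonneg hj hK
    linarith

/-- Weighting the gaps at `a` and `b` by the distances of first coordinates shows that `i` would see
`m` below the segment from `a` to `b`, and `j` would see it above. The points need not be distinct
beyond `a` and `b`. -/
lemma not_crossing {i j a m b : ι} (ham : x a 0 ≤ x m 0) (hmb : x m 0 ≤ x b 0)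
    (hab : x a 0 < x b 0) (hia : 0 ≤ gap p x i a) (hib : 0 ≤ gap p x i b) (him : gap p x i m < 0)
    (hja : gap p x j a ≤ 0) (hjb : gap p x j b ≤ 0) (hjm : 0 < gap p x j m) : False := by
  have ham' : (0 : ℚ) ≤ (x m 0 : ℚ) - x a 0 := sub_nonneg.2 (NNRat.cast_le.2 ham)
  have hmb' : (0 : ℚ) ≤ (x b 0 : ℚ) - x m 0 := sub_nonneg.2 (NNRat.cast_le.2 hmb)
  have hab' : (0 : ℚ) < (x b 0 : ℚ) - x a 0 := sub_pos.2 (NNRat.cast_lt.2 hab)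
  refine not_below_and_above (p := p) (x := x) (i := i) (j := j) (a := a) (m := m) (b := b) ?_ ?_
  · exact (mul_neg_of_pos_of_neg hab' him).trans_le
      (add_nonneg (mul_nonneg hmb' hia) (mul_nonneg ham' hib))
  · exact (add_nonpos (mul_nonpos_of_nonneg_of_nonpos hmb' hja)
      (mul_nonpos_of_nonneg_of_nonpos ham' hjb)).trans_lt (mul_pos hab' hjm)

/-- Mutual revealed preference, oriented by the first coordinate, is transitive. -/
lemma violation_trans {i j k : ι} (hij : x i 0 < x j 0) (hjk : x j 0 < x k 0)
    (h₁ : gap p x i j < 0) (h₂ : gap p x j i < 0) (h₃ : gap p x j k < 0) (h₄ : gap p x k j < 0) :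
    gap p x i k < 0 ∧ gap p x k i < 0 := by
  have hij' : (0 : ℚ) < (x j 0 : ℚ) - x i 0 := sub_pos.2 (NNRat.cast_lt.2 hij)
  have hjk' : (0 : ℚ) < (x k 0 : ℚ) - x j 0 := sub_pos.2 (NNRat.cast_lt.2 hjk)
  have hik' : (0 : ℚ) < (x k 0 : ℚ) - x i 0 := by linarith
  -- Both ends of the segment from `i` to `k` are cheaper for `j` than `j` itself, so `j` is seen
  -- above it. If one end did not find the other cheaper, it would see `j` below the segment.
  have h : ((x k 0 : ℚ) - x j 0) * gap p x j i + ((x j 0 : ℚ) - x i 0) * gap p x j k <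
      ((x k 0 : ℚ) - x i 0) * gap p x j j := by
    rw [gap_self, mul_zero]
    exact add_neg (mul_neg_of_pos_of_neg hjk' h₂) (mul_neg_of_pos_of_neg hij' h₃)
  constructor
  · by_contra! hc
    refine not_below_and_above (i := i) ?_ h
    rw [gap_self, mul_zero, zero_add]
    exact (mul_neg_of_pos_of_neg hik' h₁).trans_le (mul_nonneg hij'.le hc)
  · by_contra! hc
    refine not_below_and_above (i := k) ?_ h
    rw [gap_self, mul_zero, add_zero]
    exact (mul_neg_of_pos_of_neg hik' h₄).trans_le (mul_nonneg hjk'.le hc)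

/-! ### Rose's theorem. -/

/-- With two commodities, a finite set in which every point is revealed preferred to another one
contains a pair of points revealed preferred to each other. -/
lemma exists_mutual [DecidableEq ι] (hties : ∀ i j, i ≠ j → p i ⬝ᵥ x i ≠ p i ⬝ᵥ x j)
    (C : Finset ι) (hne : C.Nonempty) (hC : ∀ i ∈ C, ∃ j ∈ C, gap p x i j < 0) :
    ∃ i j, gap p x i j < 0 ∧ gap p x j i < 0 := by
  by_contra! hwarp
  induction C using Finset.strongInduction with
  | H C ih =>
  -- In a minimal counterexample `C`, every nonempty proper subset has a member that prefers nothing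
  -- in the subset.
  have hmin : ∀ C' ⊂ C, C'.Nonempty → ∃ i ∈ C', ∀ j ∈ C', 0 ≤ gap p x i j := by
    intro C' hC' hne'
    by_contra! h
    exact ih C' hC' hne' h
  have hirr : ∀ {i j}, gap p x i j < 0 → j ≠ i := by
    rintro i j h rfl
    simp at h
  choose! s hsC hs using hC
  -- Deleting `j` leaves a point whose only preferred point in `C` is `j`. This makes `r` injective
  -- on `C`, hence surjective, so every point has exactly one successor and one predecessor in `C`.
  have hpred : ∀ j ∈ C, ∃ i ∈ C, i ≠ j ∧ ∀ k ∈ C, gap p x i k < 0 → k = j := by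
    intro j hj
    have hne' : (C.erase j).Nonempty :=
      ⟨s j, Finset.mem_erase.2 ⟨hirr (hs j hj), hsC j hj⟩⟩
    obtain ⟨i, hi, h⟩ := hmin _ (Finset.erase_ssubset hj) hne'
    refine ⟨i, (Finset.mem_erase.1 hi).2, (Finset.mem_erase.1 hi).1, fun k hk hik => ?_⟩
    by_contra hkj
    exact absurd hik (not_lt.2 (h k (Finset.mem_erase.2 ⟨hkj, hk⟩)))
  choose! r hrC hrne hr using hpred
  have hsr : ∀ j ∈ C, s (r j) = j := fun j hj => hr j hj _ (hsC _ (hrC j hj)) (hs _ (hrC j hj))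
  have hsurj : Set.SurjOn r C C := by
    refine Finset.surjOn_of_injOn_of_card_le r (fun j hj => hrC j hj) (fun j hj k hk h => ?_) le_rfl
    rw [← hsr j hj, ← hsr k hk, h]
  have huniq : ∀ i ∈ C, ∀ k ∈ C, gap p x i k < 0 → k = s i := by
    intro i hi k hk h
    obtain ⟨j, hj, rfl⟩ := hsurj hi
    rw [hsr j hj]
    exact hr j hj k hk h
  have hpos : ∀ i ∈ C, ∀ k ∈ C, k ≠ i → k ≠ s i → 0 < gap p x i k := fun i hi k hk hki hks =>
    lt_of_le_of_ne (not_lt.1 fun h => hks (huniq i hi k hk h)) (gap_ne_zero hties hki.symm).symm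
  have hsinj : ∀ i ∈ C, ∀ j ∈ C, s i = s j → i = j := by
    intro i hi j hj h
    obtain ⟨i, hi', rfl⟩ := hsurj hi
    obtain ⟨j, hj', rfl⟩ := hsurj hj
    rw [hsr i hi', hsr j hj'] at h
    rw [h]
  -- The contradiction comes from the rightmost point `R`, its predecessor `r R` and its successor
  -- `s R`.
  obtain ⟨R, hR, hmax⟩ := C.exists_max_image (fun i => x i 0) hne
  have ha := hrC R hR
  have hc := hsC R hR
  have haR : gap p x (r R) R < 0 := by simpa [hsr R hR] using hs _ ha
  have hRc : gap p x R (s R) < 0 := hs R hR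
  have hac : s R ≠ r R := fun h => absurd (hwarp _ _ haR) (not_le.2 (h ▸ hRc))
  have hac' : 0 < gap p x (r R) (s R) :=
    hpos _ ha _ hc hac (by rw [hsr R hR]; exact hirr hRc)
  have hRa : 0 < gap p x R (r R) := hpos R hR _ ha (hrne R hR) hac.symm
  rcases lt_or_ge (x (s R) 0) (x (r R) 0) with hlt | hge
  -- If `s R` lies left of `r R`, some point `u` left of `r R` has its successor at or to the right
  -- of `r R`. Then `s u` lies between `s R` and `R`, and `u` and `R` see it on opposite sides of
  -- that segment.
  · obtain ⟨u, hu, hu'⟩ := hmin (C.filter fun i => x i 0 < x (r R) 0)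
      (Finset.filter_ssubset.2 ⟨r R, ha, lt_irrefl _⟩) ⟨s R, Finset.mem_filter.2 ⟨hc, hlt⟩⟩
    obtain ⟨huC, hulr⟩ := Finset.mem_filter.1 hu
    have hv := hsC u huC
    have hge : x (r R) 0 ≤ x (s u) 0 := by
      by_contra! h
      exact absurd (hs u huC) (not_lt.2 (hu' _ (Finset.mem_filter.2 ⟨hv, h⟩)))
    have huR : u ≠ R := by
      rintro rfl
      exact absurd (hmax _ ha) (not_le.2 hulr)
    have hvR : s u ≠ R := by
      intro h
      have : u = r R := hsinj _ huC _ ha (by rw [h, hsr R hR])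
      rw [this] at hulr
      exact lt_irrefl _ hulr
    have hvc : s u ≠ s R := fun h => huR (hsinj _ huC _ hR h)
    refine not_crossing (i := u) (j := R) (a := s R) (m := s u) (b := R) (hlt.le.trans hge)
      (hmax _ hv) (hlt.trans_le (hmax _ ha)) ?_ (hpos u huC R hR huR.symm hvR.symm).le (hs u huC)
      hRc.le (gap_self p x R).le (hpos R hR _ hv hvR hvc)
    by_cases h : s R = u
    · rw [h, gap_self]
    · exact (hpos u huC _ hc h hvc.symm).le
  -- Otherwise `s R` lies between `r R` and `R`, which see it on opposite sides of their segment,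
  -- unless all three have the same first coordinate. In that case only the second commodity counts,
  -- and `r R` would also find `s R` affordable.
  · rcases (hmax _ ha).lt_or_eq with hlt | heq
    · exact not_crossing (i := R) (j := r R) hge (hmax _ hc) hlt hRa.le (gap_self p x R).ge hRc
        (gap_self p x _).le haR.le hac'
    · have heq' : x (s R) 0 = x R 0 := le_antisymm (hmax _ hc) (heq ▸ hge)
      simp only [gap, heq, heq', sub_self, mul_zero, zero_add] at haR hRc hac' hRa
      have h₁ : (0 : ℚ) ≤ p R 1 := NNRat.cast_nonneg _
      have h₂ : (0 : ℚ) ≤ p (r R) 1 := NNRat.cast_nonneg _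
      have e₁ : (x (s R) 1 : ℚ) < x R 1 := by
        by_contra! h
        exact absurd hRc (not_lt.2 (mul_nonneg h₁ (sub_nonneg.2 h)))
      have e₂ : (x R 1 : ℚ) < x (r R) 1 := by
        by_contra! h
        exact absurd haR (not_lt.2 (mul_nonneg h₂ (sub_nonneg.2 h)))
      exact absurd hac' (not_lt.2 (mul_nonpos_of_nonneg_of_nonpos h₂ (by linarith)))

/-- Rose's theorem: with two commodities, the axiom of revealed preference says that no two points
are revealed preferred to each other. -/
theorem garp_iff [Finite ι] (hties : ∀ i j, i ≠ j → p i ⬝ᵥ x i ≠ p i ⬝ᵥ x j) :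
    GARP p x ↔ ∀ i j, ¬ (gap p x i j < 0 ∧ gap p x j i < 0) := by
  classical
  have hdr : ∀ i j, DirectlyRevealed p x i j ↔ gap p x i j < 0 := by
    intro i j
    rw [directlyRevealed_iff]
    constructor
    · exact fun h => lt_of_le_of_ne h.2 (gap_ne_zero hties h.1.symm)
    · refine fun h => ⟨?_, h.le⟩
      rintro rfl
      simp at h
  constructor
  · exact fun h i j hij => h i j (.single ((hdr i j).2 hij.1)) ((hdr j i).2 hij.2)
  · intro h i j hij hji
    cases nonempty_fintype ι
    have hii : Relation.TransGen (DirectlyRevealed p x) i i := hij.tail hji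
    -- Take all points from which a chain leads to `i`. As `i` lies on a cycle, the next point of
    -- such a chain always belongs to this set, even when it is `i`.
    obtain ⟨a, b, hab⟩ := exists_mutual hties
      (Finset.univ.filter fun k => Relation.TransGen (DirectlyRevealed p x) k i)
      ⟨i, by simpa using hii⟩ fun k hk => by
        obtain ⟨l, hkl, hli⟩ := Relation.TransGen.head'_iff.1 (Finset.mem_filter.1 hk).2
        refine ⟨l, ?_, (hdr k l).1 hkl⟩
        rcases Relation.reflTransGen_iff_eq_or_transGen.1 hli with rfl | hli
        · simpa using hii
        · simpa using hli
    exact h a b hab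

end Plane

end RevealedPreference

/-! ### The decision procedure -/

namespace RevealedPreference

open Computability StackMachine StackMachine.PolyTime

/-- The value of a fraction of binary numbers. -/
def fracValue (q : List Bool × List Bool) : ℚ := value q.1 / value q.2

/-- Multiplication of fractions. -/
def fracMul (q r : List Bool × List Bool) : List Bool × List Bool := (mulL q.1 r.1, mulL q.2 r.2)

/-- Addition of fractions. -/
def fracAdd (q r : List Bool × List Bool) : List Bool × List Bool :=
  (addL (mulL q.1 r.2) (mulL r.1 q.2), mulL q.2 r.2)

/-- Comparison of fractions. -/
def fracLe (q r : List Bool × List Bool) : Bool := leL (mulL q.1 r.2) (mulL r.1 q.2)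

lemma fracValue_mul (q r : List Bool × List Bool) :
    fracValue (fracMul q r) = fracValue q * fracValue r := by
  simp [fracValue, fracMul, mul_div_mul_comm]

lemma fracValue_add {q r : List Bool × List Bool} (hq : value q.2 ≠ 0) (hr : value r.2 ≠ 0) :
    fracValue (fracAdd q r) = fracValue q + fracValue r := by
  have hq' : (value q.2 : ℚ) ≠ 0 := Nat.cast_ne_zero.2 hq
  have hr' : (value r.2 : ℚ) ≠ 0 := Nat.cast_ne_zero.2 hr
  simp only [fracValue, fracAdd, value_addL, value_mulL, Nat.cast_add, Nat.cast_mul]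
  field_simp

lemma fracLe_iff {q r : List Bool × List Bool} (hq : value q.2 ≠ 0) (hr : value r.2 ≠ 0) :
    fracLe q r = true ↔ fracValue q ≤ fracValue r := by
  have hq' : (0 : ℚ) < value q.2 := Nat.cast_pos.2 (Nat.pos_of_ne_zero hq)
  have hr' : (0 : ℚ) < value r.2 := Nat.cast_pos.2 (Nat.pos_of_ne_zero hr)
  rw [fracLe, leL_iff, value_mulL, value_mulL, fracValue, fracValue, div_le_div_iff₀ hq' hr']
  norm_cast

/-- A data point as it is read from the input: the numerators and denominators of its prices and
quantities. -/
abbrev Point : Type := List (List Bool)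

/-- The `n`-th and the following number of a data point, as a fraction. -/
def frac (P : Point) (n : ℕ) : List Bool × List Bool :=
  ((P.drop n).headD [], (P.drop (n + 1)).headD [])

/-- The cost of the bundle of `Q` at the prices of `P`. -/
def cost (P Q : Point) : List Bool × List Bool :=
  fracAdd (fracMul (frac P 0) (frac Q 4)) (fracMul (frac P 2) (frac Q 6))

/-- Whether `P` and `Q` are revealed preferred to each other, `P` having less of the first
commodity. -/
def violation (P Q : Point) : Bool :=
  !fracLe (frac Q 4) (frac P 4) && (fracLe (cost P Q) (cost P P) && fracLe (cost Q P) (cost Q Q))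

/-- The symbols of the input as triples of Booleans. -/
def symbol : Γ' → Bool × Bool × Bool
  | .bit b => (true, b, false)
  | .comma => (false, false, true)
  | .bra => (false, true, false)
  -- Closing brackets may be ignored: reading from the right, a data point is completed at its
  -- opening bracket.
  | _ => (false, false, false)

/-- One step of reading the input from right to left: the state holds the digits of the current
number, the numbers of the current data point, and the data points. -/
def parseStep (s : List Bool × Point × List Point) (c : Bool × Bool × Bool) :
    List Bool × Point × List Point :=
  bif c.1 then (c.2.1 :: s.1, s.2)
  else bif c.2.2 then ([], s.1 :: s.2.1, s.2.2)
  else bif c.2.1 then ([], [], (s.1 :: s.2.1) :: s.2.2)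
  else s

/-- Read the input, given in reverse order. -/
def parse (w : List (Bool × Bool × Bool)) : List Bool × Point × List Point :=
  w.foldl parseStep ([], [], [])

/-- The decision procedure. -/
def decideRationality (w : List (Bool × Bool × Bool)) : Bool :=
  caseList (parse w).1 false fun sign k =>
    bif sign then false else leL (countSold (auction violation (parse w).2.2).2) k

section PolyTime

variable {α : Type} [Coded α]

@[fun_prop]
lemma polyTime_fracMul {q r : α → List Bool × List Bool} (hq : PolyTime q) (hr : PolyTime r) :
    PolyTime (fun a => fracMul (q a) (r a)) := by
  unfold fracMul; fun_prop

@[fun_prop]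
lemma polyTime_fracAdd {q r : α → List Bool × List Bool} (hq : PolyTime q) (hr : PolyTime r) :
    PolyTime (fun a => fracAdd (q a) (r a)) := by
  unfold fracAdd; fun_prop

@[fun_prop]
lemma polyTime_fracLe {q r : α → List Bool × List Bool} (hq : PolyTime q) (hr : PolyTime r) :
    PolyTime (fun a => fracLe (q a) (r a)) := by
  unfold fracLe; fun_prop

@[fun_prop]
lemma polyTime_frac {P : α → Point} (n : ℕ) (hP : PolyTime P) :
    PolyTime (fun a => frac (P a) n) := by
  unfold frac; fun_prop

@[fun_prop]
lemma polyTime_cost {P Q : α → Point} (hP : PolyTime P) (hQ : PolyTime Q) :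
    PolyTime (fun a => cost (P a) (Q a)) := by
  unfold cost; fun_prop

lemma polyTime_violation : PolyTime (fun p : Point × Point => violation p.1 p.2) := by
  unfold violation; fun_prop

@[fun_prop]
lemma polyTime_parse : PolyTime parse := by
  refine foldl_of_add (f := fun _ s c => parseStep s c) .id (.const _)
    (by unfold parseStep; fun_prop) ⟨10, fun w s c => ?_⟩
  rw [size_prod s, size_prod s.2]
  unfold parseStep
  cases c.1 <;> cases c.2.2 <;> cases c.2.1 <;>
  · simp only [cond_true, cond_false, size_pair, size_prod s, size_prod s.2, size_cons, size_nil,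
      size_bool, Polynomial.eval_ofNat]
    omega

lemma polyTime_decideRationality : PolyTime decideRationality := by
  unfold decideRationality
  refine PolyTime.list_case (by fun_prop) (by fun_prop) (PolyTime.cond (by fun_prop) (by fun_prop)
    (PolyTime.leL (PolyTime.countSold (PolyTime.snd_comp
      (PolyTime.auction polyTime_violation ?_))) (by fun_prop)))
  fun_prop

end PolyTime

/-! ### Correctness of the decision procedure -/

lemma value_encodeNat (n : ℕ) : value (encodeNat n) = n := by
  have hpos : ∀ m : PosNum, value (encodePosNum m) = (m : ℕ) := by
    intro m
    induction m with
    | one => rfl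
    | bit0 m ih => rw [encodePosNum, value, ih, PosNum.cast_bit0]; simp; ring
    | bit1 m ih => rw [encodePosNum, value, ih, PosNum.cast_bit1]; simp; ring
  have hnum : ∀ m : Num, value (encodeNum m) = (m : ℕ) := by
    rintro (_ | m)
    · rfl
    · exact hpos m
  rw [encodeNat, hnum, Num.to_of_nat]

lemma encodeNat_injective : Function.Injective encodeNat := fun a b h => by
  rw [← value_encodeNat a, h, value_encodeNat]

/-- The data point with prices `p` and bundle `x` as it is read from the input. -/
def record (p x : Fin 2 → ℚ≥0) : Point :=
  [encodeNat (p 0).num, encodeNat (p 0).den, encodeNat (p 1).num, encodeNat (p 1).den,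
    -- The empty last entry is the empty digit string after the final comma, which is stored first
    -- when reading from the right.
    encodeNat (x 0).num, encodeNat (x 0).den, encodeNat (x 1).num, encodeNat (x 1).den, []]

lemma record_inj {p x p' x' : Fin 2 → ℚ≥0} (h : record p x = record p' x') : x = x' := by
  simp only [record, List.cons.injEq, encodeNat_injective.eq_iff] at h
  obtain ⟨-, -, -, -, h₁, h₂, h₃, h₄, -⟩ := h
  funext i
  fin_cases i
  · exact NNRat.ext_num_den h₁ h₂
  · exact NNRat.ext_num_den h₃ h₄

lemma fracValue_encodeNat (q : ℚ≥0) : fracValue (encodeNat q.num, encodeNat q.den) = q := by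
  rw [fracValue, value_encodeNat, value_encodeNat]
  conv_rhs => rw [← NNRat.num_div_den q]
  push_cast
  rfl

lemma fracLe_frac_record (p x p' x' : Fin 2 → ℚ≥0) :
    fracLe (frac (record p x) 4) (frac (record p' x') 4) = true ↔ x 0 ≤ x' 0 := by
  rw [fracLe_iff (by simp [frac, record, value_encodeNat]) (by simp [frac, record, value_encodeNat])]
  simp only [frac, record, List.drop, List.headD_cons, fracValue_encodeNat, NNRat.cast_le]

lemma value_cost_record_ne_zero (p x p' x' : Fin 2 → ℚ≥0) :
    value (cost (record p x) (record p' x')).2 ≠ 0 := by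
  simp [cost, fracAdd, fracMul, frac, record, value_encodeNat]

lemma fracValue_cost_record (p x p' x' : Fin 2 → ℚ≥0) :
    fracValue (cost (record p x) (record p' x')) = (p ⬝ᵥ x' : ℚ≥0) := by
  rw [cost, fracValue_add (by simp [fracMul, frac, record, value_encodeNat])
    (by simp [fracMul, frac, record, value_encodeNat]), fracValue_mul, fracValue_mul]
  simp only [frac, record, List.drop, List.headD_cons, fracValue_encodeNat, dotProduct,
    Fin.sum_univ_two]
  push_cast
  rfl

lemma violation_record {ι : Type*} (p x : ι → Fin 2 → ℚ≥0) (i j : ι) :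
    violation (record (p i) (x i)) (record (p j) (x j)) = true ↔
      x i 0 < x j 0 ∧ gap p x i j ≤ 0 ∧ gap p x j i ≤ 0 := by
  rw [violation, Bool.and_eq_true, Bool.and_eq_true, Bool.not_eq_true', ← Bool.not_eq_true,
    fracLe_frac_record, fracLe_iff (value_cost_record_ne_zero _ _ _ _)
    (value_cost_record_ne_zero _ _ _ _), fracLe_iff (value_cost_record_ne_zero _ _ _ _)
    (value_cost_record_ne_zero _ _ _ _), fracValue_cost_record, fracValue_cost_record,
    fracValue_cost_record, fracValue_cost_record, gap_eq, gap_eq, sub_nonpos, sub_nonpos, not_le]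

section Parse

/-- One step of reading the input from right to left. -/
def parseSymbol (c : Γ') (s : List Bool × Point × List Point) : List Bool × Point × List Point :=
  parseStep s (symbol c)

lemma foldr_encNat (n : ℕ) (s : List Bool × Point × List Point) :
    (encNat n).foldr parseSymbol s = (encodeNat n ++ s.1, s.2) := by
  rw [encNat]
  induction encodeNat n with
  | nil => rfl
  | cons b l ih => rw [List.map_cons, List.foldr_cons, ih]; rfl

lemma foldr_encRat (q : ℚ≥0) (s : List Bool × Point × List Point) :
    (encRat q).foldr parseSymbol s =
      (encodeNat q.num, encodeNat q.den :: s.1 :: s.2.1, s.2.2) := by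
  simp [encRat, List.foldr_append, foldr_encNat, parseSymbol, parseStep, symbol]

lemma foldr_encVec (v : Fin 2 → ℚ≥0) (s : List Bool × Point × List Point) :
    (encVec v).foldr parseSymbol s = (encodeNat (v 0).num,
      encodeNat (v 0).den :: encodeNat (v 1).num :: encodeNat (v 1).den :: s.1 :: s.2.1, s.2.2) := by
  simp [encVec, List.ofFn_succ, List.foldr_append, foldr_encRat]

lemma foldr_points {ι : Type*} (p x : ι → Fin 2 → ℚ≥0) (l : List ι) :
    (l.flatMap fun i => Γ'.bra :: (encVec (p i) ++ encVec (x i) ++ [Γ'.ket])).foldr parseSymbol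
      ([], [], []) = ([], [], l.map fun i => record (p i) (x i)) := by
  induction l with
  | nil => rfl
  | cons i l ih =>
    rw [List.flatMap_cons, List.foldr_append, ih]
    simp [List.foldr_append, foldr_encVec, parseSymbol, parseStep, symbol, record]

lemma parse_encInstance (I : Instance 2) :
    parse ((encInstance 2 I).reverse.map symbol) =
      (decide (I.k < 0) :: encodeNat I.k.natAbs, [],
        (List.finRange I.data.size).map fun i => record (I.data.price i) (I.data.bundle i)) := by
  -- Folding over the reversed word is folding the original word from the right, so the encoding can
  -- be processed piece by piece.
  rw [parse, List.foldl_map, List.foldl_reverse]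
  change (encInstance 2 I).foldr parseSymbol _ = _
  rw [encInstance, List.foldr_append, foldr_points, encInt, List.foldr_cons, foldr_encNat]
  simp [parseSymbol, parseStep, symbol]

end Parse

lemma garp_remaining_iff (D : ConsumerData 2) (S : Finset (Fin D.size)) :
    GARP (fun i : {i // i ∉ S} => D.price i) (fun i : {i // i ∉ S} => D.bundle i) ↔
      ∀ i j, i ∉ S → j ∉ S → violation (record (D.price i) (D.bundle i))
        (record (D.price j) (D.bundle j)) = false := by
  have hties : ∀ i j : {i // i ∉ S}, i ≠ j →
      D.price i ⬝ᵥ D.bundle i ≠ D.price i ⬝ᵥ D.bundle j := fun i j hij =>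
    D.no_ties i j (Subtype.coe_injective.ne hij)
  rw [garp_iff hties]
  constructor
  · intro h i j hi hj
    rw [← Bool.not_eq_true, violation_record]
    rintro ⟨hlt, h₁, h₂⟩
    have hij : i ≠ j := by
      rintro rfl
      exact lt_irrefl _ hlt
    exact h ⟨i, hi⟩ ⟨j, hj⟩ ⟨lt_of_le_of_ne h₁ (gap_ne_zero D.no_ties hij),
      lt_of_le_of_ne h₂ (gap_ne_zero D.no_ties hij.symm)⟩
  · rintro h ⟨i, hi⟩ ⟨j, hj⟩ ⟨h₁, h₂⟩
    change gap D.price D.bundle i j < 0 at h₁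
    change gap D.price D.bundle j i < 0 at h₂
    rcases lt_trichotomy (D.bundle i 0) (D.bundle j 0) with hlt | heq | hlt
    · have := (violation_record D.price D.bundle i j).2 ⟨hlt, h₁.le, h₂.le⟩
      rw [h i j hi hj] at this
      exact Bool.false_ne_true this
    -- At equal first coordinates, the point with less of the second commodity cannot strictly
    -- prefer the other one.
    · have hp : ∀ k, (0 : ℚ) ≤ D.price k 1 := fun k => NNRat.cast_nonneg _
      simp only [gap, heq, sub_self, mul_zero, zero_add] at h₁ h₂
      rcases le_total (D.bundle i 1 : ℚ) (D.bundle j 1) with hle | hle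
      · exact absurd h₁ (not_lt.2 (mul_nonneg (hp i) (sub_nonneg.2 hle)))
      · exact absurd h₂ (not_lt.2 (mul_nonneg (hp j) (sub_nonneg.2 hle)))
    · have := (violation_record D.price D.bundle j i).2 ⟨hlt, h₂.le, h₁.le⟩
      rw [h j i hj hi] at this
      exact Bool.false_ne_true this

theorem decideRationality_iff (I : Instance 2) :
    decideRationality ((encInstance 2 I).reverse.map symbol) = true ↔ ConsumerRationality 2 I := by
  classical
  obtain ⟨D, k⟩ := I
  let rec' : Fin D.size → Point := fun i => record (D.price i) (D.bundle i)
  -- Distinct bundles give distinct records, so the list given to the auction has no repetitions and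
  -- removal sets of indices and of records correspond.
  have hinj : Function.Injective rec' := fun i j h => D.bundle_injective (record_inj h)
  simp only [decideRationality, parse_encInstance, caseList_cons, ConsumerRationality]
  rcases lt_or_ge k 0 with hk | hk
  · simp only [hk, decide_true, cond_true, Bool.false_eq_true, false_iff]
    rintro ⟨S, hS, -⟩
    omega
  · simp only [not_lt.2 hk, decide_false, cond_false, leL_iff, value_encodeNat, garp_remaining_iff]
    rw [auction_le_iff ((List.nodup_finRange _).map hinj)]
    · constructor
      · rintro ⟨S, hS, hfree⟩
        refine ⟨Finset.univ.filter fun i => rec' i ∈ S, ?_, fun i j hi hj => ?_⟩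
        · have : (Finset.univ.filter fun i => rec' i ∈ S).card ≤ S.card :=
            Finset.card_le_card_of_injOn rec' (fun i hi => (Finset.mem_filter.1 hi).2) hinj.injOn
          omega
        · exact hfree _ (List.mem_map.2 ⟨i, List.mem_finRange i, rfl⟩) _
            (List.mem_map.2 ⟨j, List.mem_finRange j, rfl⟩) (by simpa using hi) (by simpa using hj)
      · rintro ⟨S, hS, hfree⟩
        refine ⟨S.image rec', ?_, fun u hu v hv huS hvS => ?_⟩
        · have := Finset.card_image_le (s := S) (f := rec')
          omega
        · obtain ⟨i, -, rfl⟩ := List.mem_map.1 hu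
          obtain ⟨j, -, rfl⟩ := List.mem_map.1 hv
          exact hfree i j (fun h => huS (Finset.mem_image_of_mem rec' h))
            (fun h => hvS (Finset.mem_image_of_mem rec' h))
    · intro u hu v hv w hw huv hvw
      obtain ⟨a, -, rfl⟩ := List.mem_map.1 hu
      obtain ⟨b, -, rfl⟩ := List.mem_map.1 hv
      obtain ⟨c, -, rfl⟩ := List.mem_map.1 hw
      rw [violation_record] at *
      have hne : ∀ {i j}, D.bundle i 0 < D.bundle j 0 → i ≠ j := by
        rintro i j h rfl
        exact lt_irrefl _ h
      have hab := hne huv.1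
      have hbc := hne hvw.1
      have h := violation_trans huv.1 hvw.1
        (lt_of_le_of_ne huv.2.1 (gap_ne_zero D.no_ties hab))
        (lt_of_le_of_ne huv.2.2 (gap_ne_zero D.no_ties hab.symm))
        (lt_of_le_of_ne hvw.2.1 (gap_ne_zero D.no_ties hbc))
        (lt_of_le_of_ne hvw.2.2 (gap_ne_zero D.no_ties hbc.symm))
      exact ⟨huv.1.trans hvw.1, h.1.le, h.2.le⟩

end RevealedPreference

theorem mainTheorem2 :
    RevealedPreference.SolvableInPolyTime
      (RevealedPreference.encInstance 2)
      (RevealedPreference.ConsumerRationality 2) :=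
  ⟨_, RevealedPreference.decideRationality_iff,
    -- A triple of Booleans has size 17: three times 5, plus 2 for the pairings.
    StackMachine.PolyTime.tm2Computable (RevealedPreference.encInstance 2) (c := 17)
      (fun x => by simp [StackMachine.size_prod])
      RevealedPreference.polyTime_decideRationality⟩
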